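/- For an integer $n\ge 1$ and a real $0\le\alpha\le 1$, let $\mathcal T_{\alpha,n}$ be the rooted tree whose root has $m=\lceil n^{\alpha}\rceil$ children, each of which is the first node of a path with $l=\lceil n^{1-\alpha}\rceil$ nodes, so that $\mathcal T_{\alpha,n}$ has $ml+1$ nodes. A flow on a finite rooted tree is a real vector $\mu$ indexed by the nodes such that $\mu_i\ge\sum_{j}\mu_j$ for every node $i$, the sum being over the children $j$ of $i$ (so $\mu_i\ge 0$ if $i$ is a leaf); $\mathcal F(\mathcal T_{\alpha,n})$ denotes the closed convex cone of flows on $\mathcal T_{\alpha,n}$, and $\mu_1$ the value of $\mu$ at the root. Let $\sigma>0$, let $Y_i=\mu_i+\epsilon_i$ with independent $\epsilon_i\sim N(0,\sigma^2)$, one for each node $i$, and let $\hat\mu$ be the least squares estimator, i.e. the unique minimizer of $\sum_i (Y_i-f_i)^2$ over $f\in\mathcal F(\mathcal T_{\alpha,n})$. **Theorem.** For every integer $n\ge 1$ and all reals $0\le\alpha\le 1$, $\sigma>0$ and $V\ge 0$, $$ \sup_{\mu\in\mathcal F(\mathcal T_{\alpha,n}):\ \mu_1\le V}\ \mathbb E_\mu\,\frac1n\,\|\hat\mu-\mu\|^2\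 \le\ 2\Bigl(\frac{\sigma^2 V\log(en)}{n}\Bigr)^{2/3}+\frac{\sigma^2\log(en)}{n^{1-\alpha}}, $$ where $\|\cdot\|$ is the Euclidean norm on vectors indexed by the $ml+1$ nodes. -/

import Mathlib

open MeasureTheory ProbabilityTheory
open scoped ENNReal

namespace TreeFlow

/-- A rooted tree on the node set `N`, given by its parent map: the root is the only node without
a parent, and some height function strictly decreases from every node to its parent, so that
iterating the parent map from any node ends at the root. -/
structure RootedTree (N : Type*) where
  root : N
  parent : N → Option N
  parent_eq_none_iff : ∀ v, parent v = none ↔ v = root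
  acyclic : ∃ d : N → ℕ, ∀ v w, parent v = some w → d w < d v

section General

variable {N : Type*} [Fintype N] [DecidableEq N]

/-- The children of a node. -/
def RootedTree.children (T : RootedTree N) (i : N) : Finset N :=
  Finset.univ.filter fun j => T.parent j = some i

/-- The cone of flows: the value at each node is at least the sum of the values at its children
(at a leaf the sum is empty, so the value is nonnegative). -/
def RootedTree.flows (T : RootedTree N) : Set (N → ℝ) :=
  {μ | ∀ i, ∑ j ∈ T.children i, μ j ≤ μ i}

theorem RootedTree.zero_mem_flows (T : RootedTree N) : (0 : N → ℝ) ∈ T.flows := by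
  intro i
  simp

theorem RootedTree.isClosed_flows (T : RootedTree N) : IsClosed T.flows := by
  have h : T.flows = ⋂ i, {μ : N → ℝ | ∑ j ∈ T.children i, μ j ≤ μ i} := by
    ext μ
    simp [RootedTree.flows]
  rw [h]
  refine isClosed_iInter fun i => isClosed_le ?_ ?_ <;> fun_prop

/-- `f` is a least squares fit to the data `y` among the flows on `T`. -/
def RootedTree.IsLeastSquares (T : RootedTree N) (y f : N → ℝ) : Prop :=
  f ∈ T.flows ∧ ∀ g ∈ T.flows, ∑ i, (y i - f i) ^ 2 ≤ ∑ i, (y i - g i) ^ 2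

theorem RootedTree.exists_isLeastSquares (T : RootedTree N) (y : N → ℝ) :
    ∃ f, T.IsLeastSquares y f := by
  let S : Set (EuclideanSpace ℝ N) := {x | x.ofLp ∈ T.flows}
  have hS : IsClosed S := T.isClosed_flows.preimage (PiLp.continuous_ofLp 2 _)
  have hne : S.Nonempty := ⟨WithLp.toLp 2 0, T.zero_mem_flows⟩
  obtain ⟨f, hf, hd⟩ := hS.exists_infDist_eq_dist hne (WithLp.toLp 2 y)
  refine ⟨f.ofLp, hf, fun g hg => ?_⟩
  have h1 : dist (WithLp.toLp 2 y) f ≤ dist (WithLp.toLp 2 y) (WithLp.toLp 2 g) := by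
    rw [← hd]
    exact Metric.infDist_le_dist_of_mem (show WithLp.toLp 2 g ∈ S from hg)
  rw [EuclideanSpace.dist_eq, EuclideanSpace.dist_eq,
    Real.sqrt_le_sqrt_iff (Finset.sum_nonneg fun i _ => sq_nonneg _)] at h1
  simpa [Real.dist_eq, sq_abs] using h1

theorem RootedTree.isLeastSquares_unique (T : RootedTree N) {y f g : N → ℝ}
    (hf : T.IsLeastSquares y f) (hg : T.IsLeastSquares y g) : f = g := by
  have hm : (fun i => (f i + g i) / 2) ∈ T.flows := by
    intro i
    have h1 := hf.1 i
    have h2 := hg.1 i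
    rw [← Finset.sum_div, Finset.sum_add_distrib]
    linarith
  have h1 := hf.2 _ hm
  have h2 := hg.2 _ hm
  have h3 : ∑ i, (y i - (f i + g i) / 2) ^ 2 =
      (∑ i, (y i - f i) ^ 2) / 2 + (∑ i, (y i - g i) ^ 2) / 2 - (∑ i, (f i - g i) ^ 2) / 4 := by
    rw [Finset.sum_div, Finset.sum_div, Finset.sum_div, ← Finset.sum_add_distrib,
      ← Finset.sum_sub_distrib]
    exact Finset.sum_congr rfl fun i _ => by ring
  have h4 : ∑ i, (f i - g i) ^ 2 = 0 :=
    le_antisymm (by linarith) (Finset.sum_nonneg fun i _ => sq_nonneg _)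
  funext i
  have h5 := (Finset.sum_eq_zero_iff_of_nonneg fun i _ => sq_nonneg (f i - g i)).1 h4 i
    (Finset.mem_univ i)
  have h6 := pow_eq_zero_iff (two_ne_zero) |>.1 h5
  linarith

/-- The least squares estimator `y ↦ argmin_{f ∈ flows} ∑ i, (y i - f i) ^ 2`. -/
noncomputable def RootedTree.lse (T : RootedTree N) (y : N → ℝ) : N → ℝ :=
  Classical.choose (T.exists_isLeastSquares y)

theorem RootedTree.lse_isLeastSquares (T : RootedTree N) (y : N → ℝ) :
    T.IsLeastSquares y (T.lse y) :=
  Classical.choose_spec (T.exists_isLeastSquares y)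

/-- The law of the observation `Y i = μ i + ε i`, with independent `ε i ∼ N(0, σ ^ 2)`. -/
noncomputable def obsLaw (σ : ℝ) (μ : N → ℝ) : Measure (N → ℝ) :=
  Measure.pi fun i => gaussianReal (μ i) (Real.toNNReal (σ ^ 2))

end General

/-- The tree whose root (`none`) has `m` children, each of which is the first node of a path with
`l` nodes; `some (j, k)` is the `k`-th node of the `j`-th path. Here `l` is positive in all uses
(for `l = 0` or `m = 0` the tree is a single node). -/
def spider (m l : ℕ) : RootedTree (Option (Fin m × Fin l)) where
  root := none
  parent v := v.map fun p =>
    if p.2.val = 0 then none else some (p.1, ⟨p.2.val - 1, by omega⟩)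
  parent_eq_none_iff v := by cases v <;> simp
  acyclic := by
    refine ⟨fun v => v.elim 0 fun p => p.2.val + 1, ?_⟩
    rintro (_ | ⟨j, k⟩) w h
    · simp at h
    · by_cases hk : k.val = 0
      · simp [hk] at h
        subst h
        simp
      · simp [hk] at h
        subst h
        simp
        omega

/-- The tree `T_{α,n}`: `⌈n ^ α⌉` paths with `⌈n ^ (1 - α)⌉` nodes each, hanging from a root. -/
noncomputable def deepTree (α : ℝ) (n : ℕ) :
    RootedTree (Option (Fin ⌈(n : ℝ) ^ α⌉₊ × Fin ⌈(n : ℝ) ^ (1 - α)⌉₊)) :=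
  spider ⌈(n : ℝ) ^ α⌉₊ ⌈(n : ℝ) ^ (1 - α)⌉₊

end TreeFlow

/-!
The risk is bounded through the oracle inequality for least squares over a convex set: for every
flow `u`, with `ε = y - μ` and `f` the least squares fit,
`‖f - μ‖² ≤ ‖u - μ‖² + ∑ i, (2 * ε i * (f i - u i) - (f i - u i) ^ 2)`.
If `u` is constant on a block of consecutive nodes of a path, then `f - u` is nonincreasing there,
and even nonnegative if `u` vanishes on the block. The noise term therefore splits into blocks, and
the expected supremum over all admissible deviations has to be found for a single block of
length `d`.

For nonnegative nonincreasing `w` the superlevel sets are initial segments, so the layer-cake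
formula bounds `∑ i, (2 * ε i * w i - w i ^ 2)` by `∫ t in (0, ∞), 2 * max_k (S k - t * k)`, where
`S` are the partial sums of the noise (`sum_le_layerBound`). The expected maximum is given by
Spitzer's formula `E max_k S k = ∑ k, E (S k)⁺ / k`, which follows from averaging the increments of
the maximum over the cyclic shifts of the steps: over one period they telescope
(`sum_increment_le_of_periodic`, `lintegral_maxPartialSum_le`). Integration over `t` leaves
`∑ k, E ((S k)⁺) ^ 2 / k ^ 2`, that is, half the `d`-th harmonic number times the variance
(`lintegral_layerBound_le`). Without the sign restriction the cost doubles
(`hasNoiseBound_antitone`).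

It remains to choose `u`. A path whose values lie in `[0, p * Δ]` is approximated within `Δ` per
node at the cost of `p / 2` harmonic numbers: block means on layers of height `2 * Δ`, and zero on
the values below `Δ` if `p` is odd (`exists_path_approx`). Since the initial values of the paths sum
to at most `V`, the total cost is at most `V / Δ` plus the number of paths, in units of half a
harmonic number, and one for the root. The choice
`Δ = (σ ^ 2 * V * log (e * n) / n) ^ (1 / 3) / 2` balances this against the squared error, and the
slack absorbs the cost of the root as long as `n * V ^ 2` exceeds `σ ^ 2 * log (e * n)`. For smaller
`V` the zero flow is used, and the root is attached to one of the paths, so that it costs almost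
nothing (`risk_zero_le`, `risk_step_le`, `risk_deepTree_le`).
-/

open MeasureTheory ProbabilityTheory
open scoped ENNReal

namespace TreeFlow

/-! ### Maxima of partial sums and cyclic shifts -/

/-- The maximum over `0 ≤ k ≤ d` of the partial sums `x 0 + ⋯ + x (k - 1)`. It is nonnegative,
since the empty sum takes part. -/
noncomputable def maxPartialSum (x : ℕ → ℝ) (d : ℕ) : ℝ :=
  partialSups (fun k => ∑ i ∈ Finset.range k, x i) d

theorem maxPartialSum_zero (x : ℕ → ℝ) : maxPartialSum x 0 = 0 := by
  simp [maxPartialSum]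

theorem maxPartialSum_succ (x : ℕ → ℝ) (d : ℕ) :
    maxPartialSum x (d + 1) = maxPartialSum x d ⊔ ∑ i ∈ Finset.range (d + 1), x i :=
  partialSups_succ _ d

theorem sum_le_maxPartialSum (x : ℕ → ℝ) {k d : ℕ} (h : k ≤ d) :
    ∑ i ∈ Finset.range k, x i ≤ maxPartialSum x d :=
  le_partialSups_of_le (fun k => ∑ i ∈ Finset.range k, x i) h

theorem maxPartialSum_le (x : ℕ → ℝ) {d : ℕ} {c : ℝ}
    (h : ∀ k ≤ d, ∑ i ∈ Finset.range k, x i ≤ c) : maxPartialSum x d ≤ c :=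
  partialSups_le _ _ _ h

theorem maxPartialSum_congr {x y : ℕ → ℝ} {d : ℕ} (h : ∀ i < d, x i = y i) :
    maxPartialSum x d = maxPartialSum y d := by
  have key : ∀ k ≤ d, ∑ i ∈ Finset.range k, x i = ∑ i ∈ Finset.range k, y i := fun k hk =>
    Finset.sum_congr rfl fun i hi => h i ((Finset.mem_range.1 hi).trans_le hk)
  apply le_antisymm <;> refine maxPartialSum_le _ fun k hk => ?_
  · rw [key k hk]; exact sum_le_maxPartialSum y hk
  · rw [← key k hk]; exact sum_le_maxPartialSum x hk

/-- For a sequence of period `c + 1`, the amounts by which the full sum of a window exceeds all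
shorter partial sums of this window add up, over one period of starting points, to at most the
positive part of the sum over a period. If that sum is nonnegative, then each summand is at most
the increment of the window maximum of the partial sums, and these increments telescope. -/
theorem sum_increment_le_of_periodic {c : ℕ} {x : ℕ → ℝ} (hx : ∀ i, x (i + (c + 1)) = x i) :
    ∑ a ∈ Finset.range (c + 1), ((∑ i ∈ Finset.range (c + 1), x (a + i)) -
      maxPartialSum (fun i => x (a + i)) c) ⊔ 0 ≤ (∑ i ∈ Finset.range (c + 1), x i) ⊔ 0 := by
  set s : ℕ → ℝ := fun k => ∑ i ∈ Finset.range k, x i with hs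
  have hadd : ∀ a k, ∑ i ∈ Finset.range k, x (a + i) = s (a + k) - s a := by
    intro a k
    simp only [hs, Finset.sum_range_add]
    ring
  have hper : ∀ a, s (a + (c + 1)) = s a + s (c + 1) := by
    intro a
    have h1 := hadd (c + 1) a
    have h2 : ∑ i ∈ Finset.range a, x (c + 1 + i) = s a :=
      Finset.sum_congr rfl fun i _ => by rw [add_comm, hx]
    rw [add_comm a]
    linarith
  -- `G a` is the maximum of `s` over the window `a, …, a + c`.
  set G : ℕ → ℝ := fun a => maxPartialSum (fun i => x (a + i)) c + s a with hG
  have hGle : ∀ a i, i ≤ c → s (a + i) ≤ G a := by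
    intro a i hi
    have := sum_le_maxPartialSum (fun j => x (a + j)) hi
    rw [hadd] at this
    simp only [hG]
    linarith
  have hleG : ∀ a b, (∀ i ≤ c, s (a + i) ≤ b) → G a ≤ b := by
    intro a b h
    have : maxPartialSum (fun i => x (a + i)) c ≤ b - s a := by
      refine maxPartialSum_le _ fun k hk => ?_
      rw [hadd]
      linarith [h k hk]
    simp only [hG]
    linarith
  have hterm : ∀ a, (∑ i ∈ Finset.range (c + 1), x (a + i)) -
      maxPartialSum (fun i => x (a + i)) c = s (a + (c + 1)) - G a := by
    intro a
    rw [hadd]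
    simp only [hG]
    ring
  simp only [hterm]
  rcases le_total 0 (s (c + 1)) with h0 | h0
  · have hinc : ∀ a, (s (a + (c + 1)) - G a) ⊔ 0 ≤ G (a + 1) - G a := by
      intro a
      have hlast : s (a + (c + 1)) ≤ G (a + 1) := by
        have := hGle (a + 1) c le_rfl
        rwa [add_right_comm, add_assoc] at this
      refine sup_le (by linarith) (sub_nonneg.2 (hleG _ _ fun i hi => ?_))
      rcases i with _ | i
      · have := hper a
        rw [add_zero]
        linarith
      · have := hGle (a + 1) i (by omega)
        rwa [add_right_comm, add_assoc] at this
    refine (Finset.sum_le_sum fun a _ => hinc a).trans ?_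
    rw [Finset.sum_range_sub]
    refine le_sup_of_le_left (sub_le_iff_le_add.2 (hleG _ _ fun i hi => ?_))
    have h1 := hGle 0 i hi
    have h2 := hper i
    rw [zero_add] at h1
    rw [add_comm (c + 1)]
    linarith
  · -- With negative drift the end of a window never exceeds its start.
    refine (Finset.sum_nonpos fun a _ => sup_le ?_ le_rfl).trans le_sup_right
    have h1 := hGle a 0 (Nat.zero_le c)
    have h2 := hper a
    rw [add_zero] at h1
    linarith

/-! ### Spitzer's bound for the expected maximum -/

/-- The values of an injective sequence can be rotated by a permutation of the whole type. -/
theorem exists_perm_rotate {N : Type*} [DecidableEq N] {c : ℕ} {e : ℕ → N}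
    (he : Set.InjOn e (Set.Iio (c + 1))) :
    ∃ π : Equiv.Perm N, ∀ i < c + 1, π (e i) = e ((i + 1) % (c + 1)) := by
  have hnd : ((List.range (c + 1)).map e).Nodup :=
    List.Nodup.map_on (fun i hi j hj h => he (by simpa using hi) (by simpa using hj) h)
      List.nodup_range
  refine ⟨((List.range (c + 1)).map e).formPerm, fun i hi => ?_⟩
  have := List.formPerm_apply_getElem _ hnd i (by simpa using hi)
  simpa using this

theorem perm_rotate_pow {N : Type*} {c : ℕ} {e : ℕ → N} {π : Equiv.Perm N}
    (hπ : ∀ i < c + 1, π (e i) = e ((i + 1) % (c + 1))) (a : ℕ) :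
    ∀ i < c + 1, (π ^ a) (e i) = e ((a + i) % (c + 1)) := by
  induction a with
  | zero => intro i hi; simp [Nat.mod_eq_of_lt hi]
  | succ a ih =>
    intro i hi
    rw [pow_succ', Equiv.Perm.mul_apply, ih i hi, hπ _ (Nat.mod_lt _ (Nat.succ_pos c)),
      Nat.mod_add_mod, add_right_comm]

/-- A law on `N → ℝ` which is unchanged when the coordinates are permuted. -/
def Exchangeable {N : Type*} (ν : Measure (N → ℝ)) : Prop :=
  ∀ π : Equiv.Perm N, MeasurePreserving (fun ε : N → ℝ => fun i => ε (π i)) ν ν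

theorem measurable_maxPartialSum {Ω : Type*} [MeasurableSpace Ω] {f : Ω → ℕ → ℝ}
    (hf : ∀ i, Measurable fun ω => f ω i) (d : ℕ) : Measurable fun ω => maxPartialSum (f ω) d := by
  induction d with
  | zero => simp [maxPartialSum_zero]
  | succ d ih =>
    simp only [maxPartialSum_succ]
    exact ih.sup (Finset.measurable_sum _ fun i _ => hf i)

/-- Averaging over cyclic shifts bounds the expected increment of the maximal partial sum. -/
theorem lintegral_increment_le {N : Type*} [DecidableEq N] {ν : Measure (N → ℝ)}
    (hν : Exchangeable ν) {c : ℕ} {e : ℕ → N} (he : Set.InjOn e (Set.Iio (c + 1))) (t : ℝ) :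
    ∫⁻ ε, ENNReal.ofReal ((∑ i ∈ Finset.range (c + 1), (ε (e i) - t)) -
        maxPartialSum (fun i => ε (e i) - t) c) ∂ν ≤
      ((c + 1 : ℕ) : ℝ≥0∞)⁻¹ *
        ∫⁻ ε, ENNReal.ofReal (∑ i ∈ Finset.range (c + 1), (ε (e i) - t)) ∂ν := by
  obtain ⟨π, hπ⟩ := exists_perm_rotate he
  set F : (N → ℝ) → ℝ≥0∞ := fun ε =>
    ENNReal.ofReal ((∑ i ∈ Finset.range (c + 1), (ε (e i) - t)) -
      maxPartialSum (fun i => ε (e i) - t) c) with hF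
  have hMm : Measurable fun ε : N → ℝ => maxPartialSum (fun i => ε (e i) - t) c :=
    measurable_maxPartialSum (fun i => (measurable_pi_apply _).sub_const _) c
  have hFm : Measurable F := by fun_prop
  have hshift : ∀ a : ℕ, ∫⁻ ε, F (fun i => ε ((π ^ a) i)) ∂ν = ∫⁻ ε, F ε ∂ν := fun a =>
    (hν (π ^ a)).lintegral_comp hFm
  have hpt : ∀ ε : N → ℝ, ∑ a ∈ Finset.range (c + 1), F (fun i => ε ((π ^ a) i)) ≤
      ENNReal.ofReal (∑ i ∈ Finset.range (c + 1), (ε (e i) - t)) := by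
    intro ε
    set x : ℕ → ℝ := fun i => ε (e (i % (c + 1))) - t with hx
    have h1 := sum_increment_le_of_periodic (c := c) (x := x) fun i => by simp [hx]
    have h2 : ∀ a : ℕ, F (fun i => ε ((π ^ a) i)) =
        ENNReal.ofReal (((∑ i ∈ Finset.range (c + 1), x (a + i)) -
          maxPartialSum (fun i => x (a + i)) c) ⊔ 0) := by
      intro a
      have h3 : ∀ i < c + 1, ε ((π ^ a) (e i)) - t = x (a + i) := fun i hi => by
        rw [perm_rotate_pow hπ a i hi]
      simp only [hF]
      rw [maxPartialSum_congr fun i hi => h3 i (hi.trans (Nat.lt_succ_self c)),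
        Finset.sum_congr rfl fun i hi => h3 i (Finset.mem_range.1 hi)]
      simp [ENNReal.ofReal_max]
    rw [Finset.sum_congr rfl fun a _ => h2 a,
      ← ENNReal.ofReal_sum_of_nonneg fun a _ => le_sup_right]
    refine (ENNReal.ofReal_le_ofReal h1).trans (le_of_eq ?_)
    have h4 : ∑ i ∈ Finset.range (c + 1), x i = ∑ i ∈ Finset.range (c + 1), (ε (e i) - t) :=
      Finset.sum_congr rfl fun i hi => by
        simp only [hx, Nat.mod_eq_of_lt (Finset.mem_range.1 hi)]
    rw [h4]
    simp [ENNReal.ofReal_max]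
  have hsum : ((c + 1 : ℕ) : ℝ≥0∞) * ∫⁻ ε, F ε ∂ν ≤
      ∫⁻ ε, ENNReal.ofReal (∑ i ∈ Finset.range (c + 1), (ε (e i) - t)) ∂ν := by
    calc ((c + 1 : ℕ) : ℝ≥0∞) * ∫⁻ ε, F ε ∂ν
        = ∑ a ∈ Finset.range (c + 1), ∫⁻ ε, F (fun i => ε ((π ^ a) i)) ∂ν := by
          simp [hshift]
      _ = ∫⁻ ε, ∑ a ∈ Finset.range (c + 1), F (fun i => ε ((π ^ a) i)) ∂ν :=
          (lintegral_finsetSum _ fun a _ => hFm.comp (hν (π ^ a)).measurable).symm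
      _ ≤ _ := lintegral_mono hpt
  rw [mul_comm, ← div_eq_mul_inv,
    ENNReal.le_div_iff_mul_le (Or.inl (by simp)) (Or.inl (ENNReal.natCast_ne_top _)), mul_comm]
  exact hsum

/-- Spitzer's formula, as an upper bound: for exchangeable steps the expected maximum of the
partial sums is at most `∑ k, E (S k)⁺ / k`. -/
theorem lintegral_maxPartialSum_le {N : Type*} [DecidableEq N] {ν : Measure (N → ℝ)}
    (hν : Exchangeable ν) {d : ℕ} {e : ℕ → N} (he : Set.InjOn e (Set.Iio d)) (t : ℝ) :
    ∫⁻ ε, ENNReal.ofReal (maxPartialSum (fun i => ε (e i) - t) d) ∂ν ≤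
      ∑ k ∈ Finset.range d, ((k + 1 : ℕ) : ℝ≥0∞)⁻¹ *
        ∫⁻ ε, ENNReal.ofReal (∑ i ∈ Finset.range (k + 1), (ε (e i) - t)) ∂ν := by
  induction d with
  | zero => simp [maxPartialSum_zero]
  | succ c ih =>
    have hm : Measurable fun ε : N → ℝ => maxPartialSum (fun i => ε (e i) - t) c :=
      measurable_maxPartialSum (fun i => (measurable_pi_apply _).sub_const _) c
    have hsplit : ∀ ε : N → ℝ, ENNReal.ofReal (maxPartialSum (fun i => ε (e i) - t) (c + 1)) ≤
        ENNReal.ofReal (maxPartialSum (fun i => ε (e i) - t) c) +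
        ENNReal.ofReal ((∑ i ∈ Finset.range (c + 1), (ε (e i) - t)) -
          maxPartialSum (fun i => ε (e i) - t) c) := by
      intro ε
      rw [maxPartialSum_succ, ENNReal.ofReal_max]
      refine max_le le_self_add ?_
      refine le_trans (ENNReal.ofReal_le_ofReal (le_of_eq ?_)) ENNReal.ofReal_add_le
      ring
    rw [Finset.sum_range_succ]
    refine (lintegral_mono hsplit).trans ?_
    rw [lintegral_add_left hm.ennreal_ofReal]
    exact add_le_add (ih (he.mono (Set.Iio_subset_Iio (Nat.le_succ c))))
      (lintegral_increment_le hν he t)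

/-! ### Layer-cake bound for nonincreasing sequences -/

theorem ofReal_integral_le_lintegral_ofReal {Ω : Type*} [MeasurableSpace Ω] {ν : Measure Ω}
    {g : Ω → ℝ} (hg : Integrable g ν) :
    ENNReal.ofReal (∫ t, g t ∂ν) ≤ ∫⁻ t, ENNReal.ofReal (g t) ∂ν := by
  have h1 : ∫ t, g t ∂ν ≤ ∫ t, g t ⊔ 0 ∂ν := integral_mono hg hg.pos_part fun t => le_sup_left
  refine (ENNReal.ofReal_le_ofReal h1).trans (le_of_eq ?_)
  rw [ofReal_integral_eq_lintegral_ofReal hg.pos_part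
    (Filter.Eventually.of_forall fun t => le_sup_right)]
  simp [ENNReal.ofReal_max]

theorem exists_forall_le_iff_lt {w : ℕ → ℝ} {d : ℕ} (hw : AntitoneOn w (Set.Iio d)) (t : ℝ) :
    ∃ k ≤ d, ∀ i < d, t ≤ w i ↔ i < k := by
  induction d with
  | zero => exact ⟨0, le_rfl, fun i hi => absurd hi (Nat.not_lt_zero i)⟩
  | succ d ih =>
    by_cases h : t ≤ w d
    · exact ⟨d + 1, le_rfl, fun i hi => ⟨fun _ => hi, fun _ =>
        h.trans (hw hi (Nat.lt_succ_self d) (Nat.lt_succ_iff.1 hi))⟩⟩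
    · obtain ⟨k, hk, hki⟩ := ih (hw.mono (Set.Iio_subset_Iio (Nat.le_succ d)))
      refine ⟨k, hk.trans (Nat.le_succ d), fun i hi => ?_⟩
      rcases (Nat.lt_succ_iff.1 hi).lt_or_eq with h1 | rfl
      · exact hki i h1
      · exact ⟨fun h2 => absurd h2 h, fun h2 => absurd h2 (by omega)⟩

/-- The integral over all drifts `t > 0` of twice the maximal partial sum of `x i - t`. It
dominates `∑ i, (2 * x i * w i - w i ^ 2)` for every nonnegative nonincreasing `w`. -/
noncomputable def layerBound (x : ℕ → ℝ) (d : ℕ) : ℝ≥0∞ :=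
  ∫⁻ t in Set.Ioi (0 : ℝ), ENNReal.ofReal (2 * maxPartialSum (fun i => x i - t) d)

theorem integrable_indicator_Ioc_linear (w x : ℝ) :
    Integrable ((Set.Ioc 0 w).indicator fun t => 2 * (x - t)) := by
  rw [integrable_indicator_iff measurableSet_Ioc]
  exact (Continuous.integrableOn_Icc (by fun_prop)).mono_set Set.Ioc_subset_Icc_self

theorem integral_indicator_Ioc_linear {w : ℝ} (hw : 0 ≤ w) (x : ℝ) :
    ∫ t, (Set.Ioc 0 w).indicator (fun t => 2 * (x - t)) t = 2 * x * w - w ^ 2 := by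
  rw [integral_indicator measurableSet_Ioc, ← intervalIntegral.integral_of_le hw,
    intervalIntegral.integral_const_mul,
    intervalIntegral.integral_sub (by simp) (by simp)]
  simp
  ring

/-- Each superlevel set `{i | t ≤ w i}` is an initial segment, so the `t`-section of the integrand
is twice a partial sum of `x i - t`. -/
theorem sum_le_layerBound {w : ℕ → ℝ} {d : ℕ} (hw : AntitoneOn w (Set.Iio d))
    (hw0 : ∀ i < d, 0 ≤ w i) (x : ℕ → ℝ) :
    ENNReal.ofReal (∑ i ∈ Finset.range d, (2 * x i * w i - w i ^ 2)) ≤ layerBound x d := by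
  set g : ℝ → ℝ := fun t =>
    ∑ i ∈ Finset.range d, (Set.Ioc 0 (w i)).indicator (fun t => 2 * (x i - t)) t with hg
  have hint : Integrable g :=
    integrable_finsetSum _ fun i _ => integrable_indicator_Ioc_linear _ _
  have hval : ∑ i ∈ Finset.range d, (2 * x i * w i - w i ^ 2) = ∫ t, g t := by
    rw [integral_finsetSum _ fun i _ => integrable_indicator_Ioc_linear _ _]
    exact Finset.sum_congr rfl fun i hi =>
      (integral_indicator_Ioc_linear (hw0 i (Finset.mem_range.1 hi)) _).symm
  rw [hval]
  refine (ofReal_integral_le_lintegral_ofReal hint).trans ?_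
  rw [layerBound, ← lintegral_indicator measurableSet_Ioi]
  refine lintegral_mono fun t => ?_
  by_cases ht : 0 < t
  · rw [Set.indicator_of_mem (Set.mem_Ioi.2 ht)]
    refine ENNReal.ofReal_le_ofReal ?_
    obtain ⟨k, hk, hki⟩ := exists_forall_le_iff_lt hw t
    have h1 : g t = ∑ i ∈ Finset.range k, 2 * (x i - t) := by
      simp only [hg]
      rw [← Finset.sum_subset (Finset.range_subset_range.2 hk)
        (f := fun i => (Set.Ioc 0 (w i)).indicator (fun t => 2 * (x i - t)) t)]
      · refine Finset.sum_congr rfl fun i hi => Set.indicator_of_mem ?_ _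
        have hi' := Finset.mem_range.1 hi
        exact ⟨ht, (hki i (hi'.trans_le hk)).2 hi'⟩
      · intro i hi hik
        refine Set.indicator_of_notMem (fun h => hik ?_) _
        exact Finset.mem_range.2 ((hki i (Finset.mem_range.1 hi)).1 h.2)
    rw [h1, ← Finset.mul_sum]
    exact mul_le_mul_of_nonneg_left (sum_le_maxPartialSum _ hk) zero_le_two
  · have h1 : g t = 0 := Finset.sum_eq_zero fun i _ =>
      Set.indicator_of_notMem (fun h => ht h.1) _
    simp [h1]

/-- For `S = x 0 + ⋯ + x k > 0` the integrand is supported in `t ≤ S / (k + 1)`. -/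
theorem setLIntegral_ofReal_drift_le (x : ℕ → ℝ) (k : ℕ) :
    ∫⁻ t in Set.Ioi (0 : ℝ), ENNReal.ofReal (2 * ∑ i ∈ Finset.range (k + 1), (x i - t)) ≤
      ENNReal.ofReal ((∑ i ∈ Finset.range (k + 1), x i) ⊔ 0) ^ 2 / (k + 1 : ℕ) := by
  set S := ∑ i ∈ Finset.range (k + 1), x i with hS
  have hk : (0 : ℝ) < (k + 1 : ℕ) := by positivity
  set a : ℝ := (S ⊔ 0) / (k + 1 : ℕ) with ha
  have ha0 : 0 ≤ a := by positivity
  set g : ℝ → ℝ := fun t =>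
    ((k + 1 : ℕ) : ℝ) * (Set.Ioc 0 a).indicator (fun t => 2 * (a - t)) t with hg
  have hg0 : ∀ t, 0 ≤ g t := fun t => mul_nonneg hk.le
    (Set.indicator_nonneg (fun t ht => by linarith [ht.2]) t)
  have hpt : ∀ t ∈ Set.Ioi (0 : ℝ),
      ENNReal.ofReal (2 * ∑ i ∈ Finset.range (k + 1), (x i - t)) ≤ ENNReal.ofReal (g t) := by
    intro t ht
    have h1 : ∑ i ∈ Finset.range (k + 1), (x i - t) = S - (k + 1 : ℕ) * t := by
      simp [hS]
    have h2 : S ≤ (k + 1 : ℕ) * a := by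
      rw [ha, mul_div_cancel₀ _ hk.ne']
      exact le_sup_left
    rw [h1]
    by_cases hta : t ≤ a
    · refine ENNReal.ofReal_le_ofReal ?_
      simp only [hg]
      rw [Set.indicator_of_mem (show t ∈ Set.Ioc 0 a from ⟨ht, hta⟩)]
      nlinarith
    · rw [ENNReal.ofReal_of_nonpos]
      · exact zero_le
      · have h3 : ((k + 1 : ℕ) : ℝ) * a ≤ (k + 1 : ℕ) * t :=
          mul_le_mul_of_nonneg_left (not_le.1 hta).le hk.le
        linarith
  calc _ ≤ ∫⁻ t in Set.Ioi (0 : ℝ), ENNReal.ofReal (g t) :=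
        setLIntegral_mono' measurableSet_Ioi hpt
    _ ≤ ∫⁻ t, ENNReal.ofReal (g t) := setLIntegral_le_lintegral _ _
    _ = ENNReal.ofReal (∫ t, g t) :=
        (ofReal_integral_eq_lintegral_ofReal
          ((integrable_indicator_Ioc_linear a a).const_mul _)
          (Filter.Eventually.of_forall hg0)).symm
    _ = _ := by
        simp only [hg]
        rw [integral_const_mul, integral_indicator_Ioc_linear ha0,
          ← ENNReal.ofReal_pow le_sup_right, ← ENNReal.ofReal_natCast,
          ← ENNReal.ofReal_div_of_pos hk]
        congr 1
        rw [ha]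
        field_simp
        ring

/-! ### Independent Gaussian noise -/

/-- The law of independent centred Gaussian noise of variance `v` at each node. -/
noncomputable def noiseLaw (N : Type*) [Fintype N] (v : NNReal) : Measure (N → ℝ) :=
  Measure.pi fun _ => gaussianReal 0 v

section Noise

variable {N : Type*} [Fintype N] {v : NNReal}

instance : IsProbabilityMeasure (noiseLaw N v) := by
  unfold noiseLaw
  infer_instance

theorem exchangeable_noiseLaw : Exchangeable (noiseLaw N v) := fun π => by
  unfold noiseLaw
  have h := measurePreserving_piCongrLeft (fun _ : N => gaussianReal 0 v) π.symm
  convert h using 1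
  funext ε i
  simp [MeasurableEquiv.coe_piCongrLeft, Equiv.piCongrLeft_apply]

theorem measurePreserving_neg_noiseLaw :
    MeasurePreserving (fun ε : N → ℝ => fun i => -ε i) (noiseLaw N v) (noiseLaw N v) :=
  measurePreserving_pi _ _ fun _ => ⟨measurable_neg,
    (gaussianReal_map_neg (μ := 0)).trans (by rw [neg_zero])⟩

theorem memLp_eval_noiseLaw (j : N) : MemLp (fun ε : N → ℝ => ε j) 2 (noiseLaw N v) :=
  (memLp_id_gaussianReal 2).comp_measurePreserving (measurePreserving_eval _ j)

theorem integral_eval_noiseLaw (j : N) : ∫ ε, ε j ∂(noiseLaw N v) = 0 := by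
  have := integral_comp_eval (μ := fun _ : N => gaussianReal 0 v) (i := j) (f := id)
    aestronglyMeasurable_id
  simpa [noiseLaw] using this

theorem variance_eval_noiseLaw (j : N) : Var[fun ε : N → ℝ => ε j; noiseLaw N v] = v := by
  have h := (measurePreserving_eval (fun _ : N => gaussianReal 0 v) j).variance_fun_comp
    (f := id) aemeasurable_id
  simpa [noiseLaw] using h

theorem lintegral_sq_sum_noiseLaw {d : ℕ} {e : ℕ → N} (he : Set.InjOn e (Set.Iio d)) :
    ∫⁻ ε, ENNReal.ofReal ((∑ i ∈ Finset.range d, ε (e i)) ^ 2) ∂(noiseLaw N v) = d * v := by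
  have hL : MemLp (fun ε : N → ℝ => ∑ i ∈ Finset.range d, ε (e i)) 2 (noiseLaw N v) :=
    memLp_finsetSum _ fun i _ => memLp_eval_noiseLaw (e i)
  have hind : iIndepFun (fun (j : N) (ε : N → ℝ) => ε j) (noiseLaw N v) :=
    iIndepFun_pi (X := fun _ => id) fun _ => aemeasurable_id
  have hvar : Var[fun ε : N → ℝ => ∑ i ∈ Finset.range d, ε (e i); noiseLaw N v] = d * v := by
    have h := IndepFun.variance_sum (μ := noiseLaw N v) (s := Finset.range d)
      (X := fun i (ε : N → ℝ) => ε (e i)) (fun i _ => memLp_eval_noiseLaw (e i))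
      (fun i hi j hj hij => hind.indepFun fun h =>
        hij (he (by simpa using hi) (by simpa using hj) h))
    simp only [variance_eval_noiseLaw] at h
    rw [← Finset.sum_fn]
    simpa using h
  have hmean : ∫ ε, ∑ i ∈ Finset.range d, ε (e i) ∂(noiseLaw N v) = 0 := by
    rw [integral_finsetSum _ fun i _ => (memLp_eval_noiseLaw (e i)).integrable one_le_two]
    simp [integral_eval_noiseLaw]
  rw [variance_of_integral_eq_zero hL.aestronglyMeasurable.aemeasurable hmean] at hvar
  rw [← ofReal_integral_eq_lintegral_ofReal hL.integrable_sq
    (Filter.Eventually.of_forall fun ε => sq_nonneg _), hvar,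
    ENNReal.ofReal_mul (Nat.cast_nonneg d)]
  simp

/-- By symmetry the positive part of a sum carries half of its second moment. -/
theorem lintegral_posPart_sq_sum_noiseLaw {d : ℕ} {e : ℕ → N} (he : Set.InjOn e (Set.Iio d)) :
    ∫⁻ ε, ENNReal.ofReal ((∑ i ∈ Finset.range d, ε (e i)) ⊔ 0) ^ 2 ∂(noiseLaw N v) =
      d * v / 2 := by
  set F : (N → ℝ) → ℝ≥0∞ := fun ε =>
    ENNReal.ofReal ((∑ i ∈ Finset.range d, ε (e i)) ⊔ 0) ^ 2 with hF
  have hFm : Measurable F := by fun_prop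
  have hneg : ∫⁻ ε, F (fun i => -ε i) ∂(noiseLaw N v) = ∫⁻ ε, F ε ∂(noiseLaw N v) :=
    measurePreserving_neg_noiseLaw.lintegral_comp hFm
  have hsum : ∀ ε : N → ℝ, F ε + F (fun i => -ε i) =
      ENNReal.ofReal ((∑ i ∈ Finset.range d, ε (e i)) ^ 2) := by
    intro ε
    simp only [hF, Finset.sum_neg_distrib]
    rw [← ENNReal.ofReal_pow le_sup_right, ← ENNReal.ofReal_pow le_sup_right,
      ← ENNReal.ofReal_add (by positivity) (by positivity)]
    congr 1
    rcases le_total 0 (∑ i ∈ Finset.range d, ε (e i)) with h | h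
    · rw [sup_eq_left.2 h, sup_eq_right.2 (neg_nonpos.2 h)]; ring
    · rw [sup_eq_right.2 h, sup_eq_left.2 (neg_nonneg.2 h)]; ring
  have h2 : (∫⁻ ε, F ε ∂(noiseLaw N v)) * 2 = d * v := by
    rw [mul_two]
    nth_rewrite 2 [← hneg]
    rw [← lintegral_add_left hFm, ← lintegral_sq_sum_noiseLaw he]
    exact lintegral_congr hsum
  exact (ENNReal.eq_div_iff (by simp) (by simp)).2 (by rw [mul_comm]; exact h2)

end Noise

/-! ### Noise bounds for monotone blocks -/

theorem harmonic_mono_real {a b : ℕ} (h : a ≤ b) : (harmonic a : ℝ) ≤ harmonic b := by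
  have : harmonic a ≤ harmonic b := by
    unfold harmonic
    exact Finset.sum_le_sum_of_subset_of_nonneg (Finset.range_subset_range.2 h)
      fun i _ _ => by positivity
  exact_mod_cast this

theorem harmonic_nonneg_real (a : ℕ) : (0 : ℝ) ≤ harmonic a := by
  simpa using harmonic_mono_real (Nat.zero_le a)

section Blocks

variable {N : Type*} [Fintype N] {v : NNReal}

theorem measurable_layerBound {Ω : Type*} [MeasurableSpace Ω] {f : Ω → ℕ → ℝ}
    (hf : ∀ i, Measurable fun ω => f ω i) (d : ℕ) : Measurable fun ω => layerBound (f ω) d := by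
  have h : Measurable fun z : Ω × ℝ => maxPartialSum (fun i => f z.1 i - z.2) d :=
    measurable_maxPartialSum (f := fun (z : Ω × ℝ) i => f z.1 i - z.2)
      (fun i => ((hf i).comp measurable_fst).sub measurable_snd) d
  exact Measurable.lintegral_prod_right' (f := fun z : Ω × ℝ =>
    ENNReal.ofReal (2 * maxPartialSum (fun i => f z.1 i - z.2) d)) (h.const_mul 2).ennreal_ofReal

/-- Spitzer's bound is applied for each drift `t`; integrating `(S k - t * k)⁺` over `t` leaves
`(S k)⁺ ^ 2 / k`, whose expectation is `v / 2`. -/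
theorem lintegral_layerBound_le [DecidableEq N] {d : ℕ} {e : ℕ → N}
    (he : Set.InjOn e (Set.Iio d)) :
    ∫⁻ ε, layerBound (fun i => ε (e i)) d ∂(noiseLaw N v) ≤
      v * ENNReal.ofReal (harmonic d / 2) := by
  have hM : Measurable fun z : (N → ℝ) × ℝ => maxPartialSum (fun i => z.1 (e i) - z.2) d :=
    measurable_maxPartialSum (f := fun (z : (N → ℝ) × ℝ) i => z.1 (e i) - z.2)
      (fun i => by fun_prop) d
  have hS : ∀ k, Measurable fun z : ℝ × (N → ℝ) =>
      ENNReal.ofReal (2 * ∑ i ∈ Finset.range (k + 1), (z.2 (e i) - z.1)) := fun k => by fun_prop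
  have htwo : ∀ (t : ℝ) (g : (N → ℝ) → ℝ), Measurable g →
      ∫⁻ ε, ENNReal.ofReal (2 * g ε) ∂(noiseLaw N v) =
        2 * ∫⁻ ε, ENNReal.ofReal (g ε) ∂(noiseLaw N v) := by
    intro t g hg
    rw [← lintegral_const_mul _ hg.ennreal_ofReal]
    refine lintegral_congr fun ε => ?_
    rw [ENNReal.ofReal_mul zero_le_two, ENNReal.ofReal_ofNat]
  have hspitzer : ∀ t : ℝ,
      ∫⁻ ε, ENNReal.ofReal (2 * maxPartialSum (fun i => ε (e i) - t) d) ∂(noiseLaw N v) ≤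
        ∑ k ∈ Finset.range d, ((k + 1 : ℕ) : ℝ≥0∞)⁻¹ * ∫⁻ ε, ENNReal.ofReal
          (2 * ∑ i ∈ Finset.range (k + 1), (ε (e i) - t)) ∂(noiseLaw N v) := by
    intro t
    rw [htwo t _ (measurable_maxPartialSum (fun i => (measurable_pi_apply _).sub_const _) d)]
    refine (mul_le_mul_right (lintegral_maxPartialSum_le exchangeable_noiseLaw he t) 2).trans ?_
    rw [Finset.mul_sum]
    refine Finset.sum_le_sum fun k _ => le_of_eq ?_
    rw [htwo t _ (by fun_prop), mul_left_comm]
  have hterm : ∀ k ∈ Finset.range d, ((k + 1 : ℕ) : ℝ≥0∞)⁻¹ * ∫⁻ t in Set.Ioi (0 : ℝ),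
      ∫⁻ ε, ENNReal.ofReal (2 * ∑ i ∈ Finset.range (k + 1), (ε (e i) - t)) ∂(noiseLaw N v) ≤
        v * ENNReal.ofReal (((k : ℝ) + 1)⁻¹ / 2) := by
    intro k hk
    rw [lintegral_lintegral_swap (hS k).aemeasurable]
    have h1 := lintegral_mono (μ := noiseLaw N v) fun ε : N → ℝ =>
      setLIntegral_ofReal_drift_le (fun i => ε (e i)) k
    simp only [div_eq_mul_inv] at h1
    rw [lintegral_mul_const _ (by fun_prop), lintegral_posPart_sq_sum_noiseLaw
      (he.mono (Set.Iio_subset_Iio (Finset.mem_range.1 hk)))] at h1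
    refine (mul_le_mul_right h1 _).trans (le_of_eq ?_)
    have h2 : ((k + 1 : ℕ) : ℝ≥0∞) * ((k + 1 : ℕ) : ℝ≥0∞)⁻¹ = 1 :=
      ENNReal.mul_inv_cancel (by simp) (ENNReal.natCast_ne_top _)
    have h3 : ENNReal.ofReal (((k : ℝ) + 1)⁻¹ / 2) = ((k + 1 : ℕ) : ℝ≥0∞)⁻¹ * 2⁻¹ := by
      rw [div_eq_mul_inv, ENNReal.ofReal_mul (by positivity),
        ENNReal.ofReal_inv_of_pos (by positivity), ENNReal.ofReal_inv_of_pos zero_lt_two,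
        ← Nat.cast_add_one, ENNReal.ofReal_natCast, ENNReal.ofReal_ofNat]
    rw [h3, div_eq_mul_inv]
    calc ((k + 1 : ℕ) : ℝ≥0∞)⁻¹ *
          (((k + 1 : ℕ) : ℝ≥0∞) * (v : ℝ≥0∞) * 2⁻¹ * ((k + 1 : ℕ) : ℝ≥0∞)⁻¹)
        = (((k + 1 : ℕ) : ℝ≥0∞) * ((k + 1 : ℕ) : ℝ≥0∞)⁻¹) *
            ((v : ℝ≥0∞) * (((k + 1 : ℕ) : ℝ≥0∞)⁻¹ * 2⁻¹)) := by ring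
      _ = _ := by rw [h2, one_mul]
  unfold layerBound
  rw [lintegral_lintegral_swap (hM.const_mul 2).ennreal_ofReal.aemeasurable]
  refine (lintegral_mono hspitzer).trans ?_
  have hmeas : ∀ k, Measurable fun t : ℝ => ∫⁻ ε, ENNReal.ofReal
      (2 * ∑ i ∈ Finset.range (k + 1), (ε (e i) - t)) ∂(noiseLaw N v) := fun k =>
    Measurable.lintegral_prod_right' (hS k)
  rw [lintegral_finsetSum _ fun k _ => (hmeas k).const_mul _]
  calc _ ≤ ∑ k ∈ Finset.range d, v * ENNReal.ofReal (((k : ℝ) + 1)⁻¹ / 2) :=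
        Finset.sum_le_sum fun k hk => by
          rw [lintegral_const_mul _ (hmeas k)]
          exact hterm k hk
    _ = _ := by
        rw [← Finset.mul_sum, ← ENNReal.ofReal_sum_of_nonneg fun k _ => by positivity,
          ← Finset.sum_div]
        simp [harmonic]

/-- The block `e 0, …, e (d - 1)` has noise cost at most `h` against the deviations in `W`: in
expectation over centred noise of variance `v`, the supremum over `w ∈ W` of
`∑ i, (2 * ε (e i) * w i - w i ^ 2)` is at most `v * h`. To avoid measurability questions about
the supremum, a measurable majorant is asked for. -/
def HasNoiseBound (v : NNReal) (e : ℕ → N) (d : ℕ) (W : Set (ℕ → ℝ)) (h : ℝ) : Prop :=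
  ∃ Φ : (N → ℝ) → ℝ≥0∞, Measurable Φ ∧ ∫⁻ ε, Φ ε ∂(noiseLaw N v) ≤ v * ENNReal.ofReal h ∧
    ∀ ε, ∀ w ∈ W,
      ENNReal.ofReal (∑ i ∈ Finset.range d, (2 * ε (e i) * w i - w i ^ 2)) ≤ Φ ε

theorem HasNoiseBound.mono {e : ℕ → N} {d : ℕ} {W W' : Set (ℕ → ℝ)} {h h' : ℝ}
    (H : HasNoiseBound v e d W h) (hW : W' ⊆ W) (hh : h ≤ h') : HasNoiseBound v e d W' h' := by
  obtain ⟨Φ, h1, h2, h3⟩ := H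
  exact ⟨Φ, h1, h2.trans (mul_le_mul_right (ENNReal.ofReal_le_ofReal hh) _),
    fun ε w hw => h3 ε w (hW hw)⟩

theorem HasNoiseBound.append {e : ℕ → N} {b d : ℕ} {W W' : Set (ℕ → ℝ)} {h h' : ℝ}
    (H : HasNoiseBound v e b W h) (H' : HasNoiseBound v (fun i => e (b + i)) d W' h')
    (hh : 0 ≤ h) (hh' : 0 ≤ h') :
    HasNoiseBound v e (b + d) {w | w ∈ W ∧ (fun i => w (b + i)) ∈ W'} (h + h') := by
  obtain ⟨Φ, h1, h2, h3⟩ := H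
  obtain ⟨Φ', h1', h2', h3'⟩ := H'
  refine ⟨fun ε => Φ ε + Φ' ε, h1.add h1', ?_, fun ε w hw => ?_⟩
  · rw [lintegral_add_left h1, ENNReal.ofReal_add hh hh', mul_add]
    exact add_le_add h2 h2'
  · rw [Finset.sum_range_add]
    exact ENNReal.ofReal_add_le.trans (add_le_add (h3 ε w hw.1) (h3' ε _ hw.2))

theorem hasNoiseBound_antitone_nonneg [DecidableEq N] {e : ℕ → N} {d : ℕ}
    (he : Set.InjOn e (Set.Iio d)) :
    HasNoiseBound v e d {w | AntitoneOn w (Set.Iio d) ∧ ∀ i < d, 0 ≤ w i} (harmonic d / 2) :=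
  ⟨fun ε => layerBound (fun i => ε (e i)) d,
    measurable_layerBound (fun _ => measurable_pi_apply _) d, lintegral_layerBound_le he,
    fun _ _ hw => sum_le_layerBound hw.1 hw.2 _⟩

/-- The positive part of a nonincreasing sequence is nonincreasing, and so is its negative part
after reversal. -/
theorem sum_le_layerBound_add_layerBound {w : ℕ → ℝ} {d : ℕ} (hw : AntitoneOn w (Set.Iio d))
    (x : ℕ → ℝ) :
    ENNReal.ofReal (∑ i ∈ Finset.range d, (2 * x i * w i - w i ^ 2)) ≤
      layerBound x d + layerBound (fun i => -x (d - 1 - i)) d := by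
  have h1 := sum_le_layerBound (w := fun i => w i ⊔ 0) (d := d)
    (fun i hi j hj hij => sup_le_sup_right (hw hi hj hij) 0) (fun _ _ => le_sup_right) x
  have h2 := sum_le_layerBound (w := fun i => -w (d - 1 - i) ⊔ 0) (d := d)
    (fun i hi j hj hij => sup_le_sup_right (neg_le_neg (hw
      (show d - 1 - j < d by have : j < d := hj; omega)
      (show d - 1 - i < d by have : i < d := hi; omega) (by omega))) 0)
    (fun _ _ => le_sup_right) fun i => -x (d - 1 - i)
  refine le_trans ?_ (add_le_add h1 h2)
  have h3 := Finset.sum_range_reflect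
    (fun i => 2 * -x i * (-w i ⊔ 0) - (-w i ⊔ 0) ^ 2) d
  refine le_trans (ENNReal.ofReal_le_ofReal (le_of_eq ?_)) ENNReal.ofReal_add_le
  refine Eq.trans ?_ (congrArg (_ + ·) h3.symm)
  rw [← Finset.sum_add_distrib]
  refine Finset.sum_congr rfl fun i _ => ?_
  rcases le_total 0 (w i) with h | h
  · rw [sup_eq_left.2 h, sup_eq_right.2 (neg_nonpos.2 h)]; ring
  · rw [sup_eq_right.2 h, sup_eq_left.2 (neg_nonneg.2 h)]; ring

theorem lintegral_layerBound_neg_le [DecidableEq N] {d : ℕ} {e : ℕ → N}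
    (he : Set.InjOn e (Set.Iio d)) :
    ∫⁻ ε, layerBound (fun i => -ε (e i)) d ∂(noiseLaw N v) ≤
      v * ENNReal.ofReal (harmonic d / 2) := by
  have hm : Measurable fun ε : N → ℝ => layerBound (fun i => ε (e i)) d :=
    measurable_layerBound (fun i => measurable_pi_apply _) d
  exact (measurePreserving_neg_noiseLaw.lintegral_comp hm).trans_le (lintegral_layerBound_le he)

/-- Without the sign restriction of `hasNoiseBound_antitone_nonneg` the positive and the negative
part of a deviation cost half a harmonic number each. -/
theorem hasNoiseBound_antitone [DecidableEq N] {e : ℕ → N} {d : ℕ}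
    (he : Set.InjOn e (Set.Iio d)) :
    HasNoiseBound v e d {w | AntitoneOn w (Set.Iio d)} (harmonic d) := by
  have he' : Set.InjOn (fun i => e (d - 1 - i)) (Set.Iio d) := by
    intro i hi j hj h
    have hi' : i < d := hi
    have hj' : j < d := hj
    have := he (show d - 1 - i < d by omega) (show d - 1 - j < d by omega) h
    omega
  have hm1 : Measurable fun ε : N → ℝ => layerBound (fun i => ε (e i)) d :=
    measurable_layerBound (fun i => measurable_pi_apply _) d
  have hm2 : Measurable fun ε : N → ℝ => layerBound (fun i => -ε (e (d - 1 - i))) d :=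
    measurable_layerBound (fun i => (measurable_pi_apply _).neg) d
  refine ⟨_, hm1.add hm2, ?_,
    fun ε w hw => sum_le_layerBound_add_layerBound hw fun i => ε (e i)⟩
  have h0 : (0 : ℝ) ≤ harmonic d / 2 := div_nonneg (harmonic_nonneg_real d) zero_le_two
  rw [show (harmonic d : ℝ) = harmonic d / 2 + harmonic d / 2 by ring, ENNReal.ofReal_add h0 h0,
    mul_add]
  exact (lintegral_add_left hm1 _).trans_le
    (add_le_add (lintegral_layerBound_le he) (lintegral_layerBound_neg_le he'))

/-! ### Approximation of a nonincreasing sequence along a path -/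

/-- The deviations `f - u` of nonnegative nonincreasing sequences `f` from `u`. -/
def pathDeviations (l : ℕ) (u : ℕ → ℝ) : Set (ℕ → ℝ) :=
  {w | ∃ f : ℕ → ℝ, AntitoneOn f (Set.Iio l) ∧ (∀ i < l, 0 ≤ f i) ∧ w = fun i => f i - u i}

/-- The mean minimizes the sum of squared deviations, so it does at least as well as the midpoint
of an interval which holds all values. -/
theorem sum_sq_mean_sub_le {a : ℕ → ℝ} {d : ℕ} {c Δ : ℝ} (h1 : ∀ i < d, c ≤ a i)
    (h2 : ∀ i < d, a i ≤ c + 2 * Δ) :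
    ∑ i ∈ Finset.range d, ((∑ j ∈ Finset.range d, a j) / d - a i) ^ 2 ≤ d * Δ ^ 2 := by
  rcases Nat.eq_zero_or_pos d with rfl | hd
  · simp
  set m := (∑ j ∈ Finset.range d, a j) / d with hm
  have hd' : (0 : ℝ) < d := Nat.cast_pos.2 hd
  have hs : ∑ j ∈ Finset.range d, a j = d * m := by rw [hm]; field_simp
  have hkey : ∑ i ∈ Finset.range d, (m - a i) ^ 2 =
      ∑ i ∈ Finset.range d, (a i - (c + Δ)) ^ 2 - d * (m - (c + Δ)) ^ 2 := by
    have : ∀ i, (m - a i) ^ 2 =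
        (a i - (c + Δ)) ^ 2 + (m ^ 2 - (c + Δ) ^ 2) - 2 * (m - (c + Δ)) * a i := fun i => by ring
    simp only [this]
    rw [Finset.sum_sub_distrib, Finset.sum_add_distrib, ← Finset.mul_sum, hs]
    simp
    ring
  rw [hkey]
  have hle : ∑ i ∈ Finset.range d, (a i - (c + Δ)) ^ 2 ≤ d * Δ ^ 2 := by
    have := Finset.sum_le_card_nsmul (Finset.range d) (fun i => (a i - (c + Δ)) ^ 2) (Δ ^ 2)
      fun i hi => by
        have := h1 i (Finset.mem_range.1 hi)
        have := h2 i (Finset.mem_range.1 hi)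
        exact sq_le_sq' (by linarith) (by linarith)
    simpa using this
  nlinarith [mul_nonneg hd'.le (sq_nonneg (m - (c + Δ)))]

theorem le_mean {a : ℕ → ℝ} {d : ℕ} {c : ℝ} (hd : 0 < d) (h : ∀ i < d, c ≤ a i) :
    c ≤ (∑ j ∈ Finset.range d, a j) / d := by
  rw [le_div_iff₀ (Nat.cast_pos.2 hd), mul_comm]
  simpa using Finset.card_nsmul_le_sum (Finset.range d) a c fun i hi => h i (Finset.mem_range.1 hi)

theorem mean_le {a : ℕ → ℝ} {d : ℕ} {c : ℝ} (hd : 0 < d) (h : ∀ i < d, a i ≤ c) :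
    (∑ j ∈ Finset.range d, a j) / d ≤ c := by
  rw [div_le_iff₀ (Nat.cast_pos.2 hd), mul_comm]
  simpa using Finset.sum_le_card_nsmul (Finset.range d) a c fun i hi => h i (Finset.mem_range.1 hi)

/-- A nonincreasing sequence with values in `[0, p * Δ]` is within `Δ` in mean square of a step
function with noise cost `p / 2` harmonic numbers: the values below `Δ` (for odd `p`) are replaced
by `0`, at half a harmonic number, and each of the remaining `⌊p / 2⌋` layers of height `2 * Δ` by
its mean, at a full one. Taking means keeps the initial value from increasing. -/
theorem exists_path_approx [DecidableEq N] {Δ : ℝ} (hΔ : 0 ≤ Δ) (q : ℕ) :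
    ∀ {l : ℕ} {e : ℕ → N} {a : ℕ → ℝ}, Set.InjOn e (Set.Iio l) → AntitoneOn a (Set.Iio l) →
      (∀ i < l, 0 ≤ a i) → (∀ i < l, a i ≤ ((q + 1 : ℕ) : ℝ) * Δ) →
      ∃ u : ℕ → ℝ, AntitoneOn u (Set.Iio l) ∧ (∀ i < l, 0 ≤ u i) ∧ (∀ i < l, u i ≤ a 0) ∧
        ∑ i ∈ Finset.range l, (u i - a i) ^ 2 ≤ l * Δ ^ 2 ∧
        HasNoiseBound v e l (pathDeviations l u) (((q + 1 : ℕ) : ℝ) * harmonic l / 2) := by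
  induction q using Nat.twoStepInduction with
  | zero =>
    intro l e a he ha ha0 haΔ
    refine ⟨fun _ => 0, antitoneOn_const, fun _ _ => le_rfl,
      fun i hi => ha0 0 (Nat.zero_lt_of_lt hi), ?_, ?_⟩
    · have := Finset.sum_le_card_nsmul (Finset.range l) (fun i => (0 - a i) ^ 2) (Δ ^ 2)
        fun i hi => by
          have h1 := ha0 i (Finset.mem_range.1 hi)
          have h2 := haΔ i (Finset.mem_range.1 hi)
          simp only [zero_add, Nat.cast_one, one_mul] at h2
          exact sq_le_sq' (by linarith) (by linarith)
      simpa using this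
    · refine (hasNoiseBound_antitone_nonneg he).mono ?_ (by simp)
      rintro w ⟨f, hf, hf0, rfl⟩
      simpa using ⟨hf, hf0⟩
  | one =>
    intro l e a he ha ha0 haΔ
    refine ⟨fun _ => (∑ j ∈ Finset.range l, a j) / l, antitoneOn_const,
      fun i hi => le_mean (Nat.zero_lt_of_lt hi) ha0,
      fun i hi => mean_le (Nat.zero_lt_of_lt hi)
        fun j hj => ha (Nat.zero_lt_of_lt hi) hj (Nat.zero_le j),
      sum_sq_mean_sub_le ha0 fun i hi => (haΔ i hi).trans (by norm_num), ?_⟩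
    refine (hasNoiseBound_antitone he).mono ?_ (by norm_num)
    rintro w ⟨f, hf, hf0, rfl⟩
    exact fun i hi j hj hij => sub_le_sub_right (hf hi hj hij) _
  | more q ih _ =>
    intro l e a he ha ha0 haΔ
    obtain ⟨b, hb, hbi⟩ := exists_forall_le_iff_lt ha (((q + 1 : ℕ) : ℝ) * Δ)
    obtain ⟨c, rfl⟩ := Nat.exists_eq_add_of_le hb
    have hsub : ∀ i < c, b + i < b + c := fun i hi => Nat.add_lt_add_left hi b
    have hlow : ∀ i < b, ((q + 1 : ℕ) : ℝ) * Δ ≤ a i := fun i hi =>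
      (hbi i (hi.trans_le hb)).2 hi
    have hhigh : ∀ i < c, a (b + i) ≤ ((q + 1 : ℕ) : ℝ) * Δ := fun i hi =>
      (not_le.1 fun h => absurd ((hbi _ (hsub i hi)).1 h) (by omega)).le
    obtain ⟨u, hu, hu0, hua, hue, hun⟩ := ih (l := c) (e := fun i => e (b + i))
      (a := fun i => a (b + i))
      (fun i hi j hj h => Nat.add_left_cancel (he (hsub i hi) (hsub j hj) h))
      (fun i hi j hj h => ha (hsub i hi) (hsub j hj) (Nat.add_le_add_left h b))
      (fun i hi => ha0 _ (hsub i hi)) hhigh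
    set m := (∑ j ∈ Finset.range b, a j) / b with hm
    have hq0 : (0 : ℝ) ≤ ((q + 1 : ℕ) : ℝ) * Δ := by positivity
    set U : ℕ → ℝ := fun i => if i < b then m else u (i - b) with hU
    have hU1 : ∀ i < b, U i = m := fun i hi => if_pos hi
    have hU2 : ∀ i, U (b + i) = u i := fun i => by simp [hU]
    have hle : ∀ i < c, u i ≤ ((q + 1 : ℕ) : ℝ) * Δ := fun i hi =>
      (hua i hi).trans (hhigh 0 (Nat.zero_lt_of_lt hi))
    refine ⟨U, ?_, ?_, ?_, ?_, ?_⟩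
    · intro i hi j hj hij
      by_cases hjb : j < b
      · rw [hU1 i (hij.trans_lt hjb), hU1 j hjb]
      · obtain ⟨j, rfl⟩ := Nat.exists_eq_add_of_le (not_lt.1 hjb)
        have hjc : j < c := Nat.lt_of_add_lt_add_left hj
        rw [hU2]
        by_cases hib : i < b
        · rw [hU1 i hib]
          exact (hle j hjc).trans (le_mean (Nat.zero_lt_of_lt hib) hlow)
        · obtain ⟨i, rfl⟩ := Nat.exists_eq_add_of_le (not_lt.1 hib)
          rw [hU2]
          exact hu (Nat.lt_of_add_lt_add_left hi) hjc (Nat.le_of_add_le_add_left hij)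
    · intro i hi
      by_cases hib : i < b
      · rw [hU1 i hib]
        exact hq0.trans (le_mean (Nat.zero_lt_of_lt hib) hlow)
      · obtain ⟨i, rfl⟩ := Nat.exists_eq_add_of_le (not_lt.1 hib)
        rw [hU2]
        exact hu0 i (Nat.lt_of_add_lt_add_left hi)
    · intro i hi
      have h0 : 0 < b + c := Nat.zero_lt_of_lt hi
      by_cases hib : i < b
      · rw [hU1 i hib]
        exact mean_le (Nat.zero_lt_of_lt hib)
          fun j hj => ha h0 (hj.trans_le hb) (Nat.zero_le j)
      · obtain ⟨i, rfl⟩ := Nat.exists_eq_add_of_le (not_lt.1 hib)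
        rw [hU2]
        have hic : i < c := Nat.lt_of_add_lt_add_left hi
        exact (hua i hic).trans (ha h0 (hsub 0 (Nat.zero_lt_of_lt hic)) (Nat.zero_le _))
    · rw [Finset.sum_range_add]
      have h1 : ∑ i ∈ Finset.range b, (U i - a i) ^ 2 ≤ b * Δ ^ 2 := by
        rw [Finset.sum_congr rfl fun i hi => by rw [hU1 i (Finset.mem_range.1 hi)]]
        refine sum_sq_mean_sub_le hlow fun i hi => (haΔ i (hi.trans_le hb)).trans (le_of_eq ?_)
        push_cast
        ring
      have h2 : ∑ i ∈ Finset.range c, (U (b + i) - a (b + i)) ^ 2 ≤ c * Δ ^ 2 := by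
        simpa only [hU2] using hue
      push_cast
      linarith
    · have hb0 := harmonic_nonneg_real b
      have hc0 := harmonic_nonneg_real c
      have hb1 := harmonic_mono_real (Nat.le_add_right b c)
      have hc1 := harmonic_mono_real (Nat.le_add_left c b)
      refine ((hasNoiseBound_antitone (he.mono (Set.Iio_subset_Iio hb))).append hun hb0
        (by positivity)).mono ?_ ?_
      · rintro w ⟨f, hf, hf0, rfl⟩
        refine ⟨fun i hi j hj hij => ?_, fun i => f (b + i),
          fun i hi j hj h => hf (hsub i hi) (hsub j hj) (Nat.add_le_add_left h b),
          fun i hi => hf0 _ (hsub i hi), ?_⟩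
        · simp only [hU1 i hi, hU1 j hj]
          exact sub_le_sub_right (hf (Set.Iio_subset_Iio hb hi) (Set.Iio_subset_Iio hb hj) hij) _
        · simp only [hU2]
      · have h3 := mul_le_mul_of_nonneg_left hc1 (show (0 : ℝ) ≤ ((q + 1 : ℕ) : ℝ) by positivity)
        push_cast at h3 ⊢
        nlinarith

end Blocks

/-! ### Numerical bounds for harmonic numbers and the tree dimensions -/

/-- The second summand on the left is the additional cost of a path of `l` nodes when the root is
attached to it. -/
theorem harmonic_add_le_one_add_log {l n : ℕ} (hl : 1 ≤ l) (hln : l ≤ n) (hn : 2 ≤ n) :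
    (harmonic l : ℝ) + 1 / (2 * (l + 1)) ≤ 1 + Real.log n := by
  have hlog2 := Real.log_two_gt_d9
  rcases hl.eq_or_lt with rfl | hl2
  · have : Real.log 2 ≤ Real.log n := Real.log_le_log two_pos (by exact_mod_cast hn)
    norm_num [harmonic]
    linarith
  · have hl2' : (2 : ℝ) ≤ l := by exact_mod_cast hl2
    have h1 := Real.strictAnti_eulerMascheroniSeq'.antitone (show 2 ≤ l from hl2)
    simp only [Real.eulerMascheroniSeq', if_neg (show l ≠ 0 by omega),
      if_neg (show (2 : ℕ) ≠ 0 by omega)] at h1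
    norm_num [harmonic, Finset.sum_range_succ] at h1
    have h2 : Real.log l ≤ Real.log n :=
      Real.log_le_log (by linarith) (by exact_mod_cast hln)
    have h3 : 1 / (2 * ((l : ℝ) + 1)) ≤ 1 / 6 :=
      one_div_le_one_div_of_le (by norm_num) (by linarith)
    have h4 : (harmonic l : ℝ) = ∑ i ∈ Finset.range l, ((i : ℝ) + 1)⁻¹ := by simp [harmonic]
    linarith

theorem log_exp_one_mul {n : ℕ} (hn : 1 ≤ n) :
    Real.log (Real.exp 1 * n) = 1 + Real.log n := by
  rw [Real.log_mul (Real.exp_ne_zero 1) (by positivity), Real.log_exp]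

/-- With `⌈M⌉ = a + 1` and `⌈n / M⌉ = b + 1` one has `a * b < n`, which for positive `a` and `b`
also gives `a + b ≤ a * b + 1 ≤ n`. -/
theorem ceil_mul_ceil_le {n : ℕ} {M : ℝ} (hM : 1 ≤ M) (hMn : M ≤ n) :
    ⌈M⌉₊ * ⌈n / M⌉₊ ≤ 2 * n := by
  have hM0 : 0 < M := by linarith
  have hn0 : (0 : ℝ) < n := by linarith
  have hm : ⌈M⌉₊ ≤ n := Nat.ceil_le.2 hMn
  have hl : ⌈n / M⌉₊ ≤ n := Nat.ceil_le.2 (div_le_self hn0.le hM)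
  obtain ⟨a, ha⟩ := Nat.exists_eq_add_of_le' (Nat.ceil_pos.2 hM0)
  obtain ⟨b, hb⟩ := Nat.exists_eq_add_of_le' (Nat.ceil_pos.2 (div_pos hn0 hM0))
  have ha' : (a : ℝ) < M := by
    have := Nat.ceil_lt_add_one hM0.le
    rw [ha] at this
    push_cast at this
    linarith
  have hb' : (b : ℝ) < n / M := by
    have := Nat.ceil_lt_add_one (div_pos hn0 hM0).le
    rw [hb] at this
    push_cast at this
    linarith
  have hab : a * b < n := by
    have h : (a : ℝ) * b < M * (n / M) := mul_lt_mul'' ha' hb' (by positivity) (by positivity)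
    rw [mul_div_cancel₀ _ hM0.ne'] at h
    exact_mod_cast h
  rw [ha] at hm
  rw [hb] at hl
  rw [ha, hb]
  rcases Nat.eq_zero_or_pos a with rfl | ha0
  · omega
  rcases Nat.eq_zero_or_pos b with rfl | hb0
  · omega
  obtain ⟨a, rfl⟩ := Nat.exists_eq_add_of_le' ha0
  obtain ⟨b, rfl⟩ := Nat.exists_eq_add_of_le' hb0
  ring_nf at hab ⊢
  omega

theorem ceil_le_two_mul {M : ℝ} (hM : 1 ≤ M) : (⌈M⌉₊ : ℝ) ≤ 2 * M := by
  have := Nat.ceil_lt_add_one (show 0 ≤ M by linarith)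
  linarith

/-- The noise cost of the zero fit, with the root attached to one of the paths. -/
theorem noiseCost_zero_le {n : ℕ} (hn : 1 ≤ n) {M : ℝ} (hM : 1 ≤ M) (hMn : M ≤ n) :
    (harmonic (⌈n / M⌉₊ + 1) : ℝ) / 2 + (⌈M⌉₊ - 1) * (harmonic ⌈n / M⌉₊ / 2) ≤
      M * (1 + Real.log n) := by
  have hM0 : 0 < M := by linarith
  have hn0 : (0 : ℝ) < n := by linarith
  have hl1 : 1 ≤ ⌈n / M⌉₊ := Nat.ceil_pos.2 (div_pos hn0 hM0)
  have hl : ⌈n / M⌉₊ ≤ n := Nat.ceil_le.2 (div_le_self hn0.le hM)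
  have hm := ceil_le_two_mul hM
  set l := ⌈n / M⌉₊
  rcases hn.eq_or_lt with rfl | hn2
  · have hM1 : M = 1 := le_antisymm (by simpa using hMn) hM
    have hl' : l = 1 := le_antisymm hl hl1
    rw [hl', hM1]
    norm_num [harmonic, Finset.sum_range_succ]
  · have h1 := harmonic_add_le_one_add_log hl1 hl hn2
    have h2 : (harmonic (l + 1) : ℝ) = harmonic l + 1 / (l + 1) := by
      rw [harmonic_succ]
      push_cast
      rw [one_div]
    have h3 : 1 / (2 * ((l : ℝ) + 1)) = 1 / (l + 1) / 2 := by field_simp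
    have h4 : (0 : ℝ) < 1 / (l + 1) := by positivity
    have h5 := harmonic_nonneg_real l
    rw [h3] at h1
    rw [h2]
    nlinarith [mul_le_mul_of_nonneg_right hm h5, mul_le_mul_of_nonneg_left h1 hM0.le,
      mul_nonneg (sub_nonneg.2 hM) h4.le]

/-- The noise cost of a free root together with half a harmonic number per path. -/
theorem noiseCost_root_free_le {n : ℕ} (hn : 1 ≤ n) {M : ℝ} (hM : 1 ≤ M) (hMn : M ≤ n) :
    1 + ⌈M⌉₊ * (harmonic ⌈n / M⌉₊ : ℝ) / 2 ≤
      M * (1 + Real.log n) + (1 + Real.log n) / 2 := by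
  have hM0 : 0 < M := by linarith
  have hn0 : (0 : ℝ) < n := by linarith
  have hl1 : 1 ≤ ⌈n / M⌉₊ := Nat.ceil_pos.2 (div_pos hn0 hM0)
  have hl : ⌈n / M⌉₊ ≤ n := Nat.ceil_le.2 (div_le_self hn0.le hM)
  have hm := ceil_le_two_mul hM
  set l := ⌈n / M⌉₊
  rcases hn.eq_or_lt with rfl | hn2
  · have hM1 : M = 1 := le_antisymm (by simpa using hMn) hM
    have hl' : l = 1 := le_antisymm hl hl1
    rw [hl', hM1]
    norm_num [harmonic, Finset.sum_range_succ]
  · have h1 := harmonic_add_le_one_add_log hl1 hl hn2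
    have h5 := harmonic_nonneg_real l
    have h6 := mul_le_mul_of_nonneg_right hm h5
    have h7 : (1 : ℝ) ≤ 1 / (2 * (l + 1)) + (1 + Real.log n) / 2 := by
      have hlog2 := Real.log_two_gt_d9
      rcases (show 2 ≤ n from hn2).eq_or_lt with rfl | hn3
      · have hl2 : (l : ℝ) ≤ 2 := by exact_mod_cast hl
        have h8 : (1 : ℝ) / 6 ≤ 1 / (2 * (l + 1)) :=
          one_div_le_one_div_of_le (by positivity) (by linarith)
        push_cast
        linarith
      · have h8 : 1 ≤ Real.log n := by
          rw [Real.le_log_iff_exp_le hn0]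
          have : (3 : ℝ) ≤ n := by exact_mod_cast hn3
          linarith [Real.exp_one_lt_d9]
        have h9 : (0 : ℝ) < 1 / (2 * (l + 1)) := by positivity
        linarith
    have h10 : (0 : ℝ) < 1 / (2 * ((l : ℝ) + 1)) := by positivity
    nlinarith [mul_nonneg (sub_nonneg.2 hM) (show 0 ≤ 1 + Real.log n - harmonic l by linarith)]

/-! ### Oracle inequality for the least squares estimator -/

theorem measurePreserving_sub_obsLaw {N : Type*} [Fintype N] (σ : ℝ) (μ : N → ℝ) :
    MeasurePreserving (fun y : N → ℝ => fun i => y i - μ i) (obsLaw σ μ)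
      (noiseLaw N (Real.toNNReal (σ ^ 2))) :=
  measurePreserving_pi _ _ fun i =>
    ⟨measurable_id.sub_const _, (gaussianReal_map_sub_const (μ i)).trans (by rw [sub_self])⟩

section Oracle

variable {N : Type*} [Fintype N] [DecidableEq N]

/-- The first order condition for the projection onto a convex set. -/
theorem RootedTree.IsLeastSquares.inner_le_zero {T : RootedTree N} {y f u : N → ℝ}
    (hf : T.IsLeastSquares y f) (hu : u ∈ T.flows) : ∑ i, (y i - f i) * (u i - f i) ≤ 0 := by
  set A := ∑ i, (y i - f i) * (u i - f i) with hA
  set B := ∑ i, (u i - f i) ^ 2 with hB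
  have hB0 : 0 ≤ B := Finset.sum_nonneg fun i _ => sq_nonneg _
  have hstep : ∀ t : ℝ, 0 ≤ t → t ≤ 1 → 2 * t * A ≤ t ^ 2 * B := by
    intro t ht0 ht1
    have hmem : (fun i => f i + t * (u i - f i)) ∈ T.flows := by
      intro i
      have h1 := mul_le_mul_of_nonneg_left (hf.1 i) (sub_nonneg.2 ht1)
      have h2 := mul_le_mul_of_nonneg_left (hu i) ht0
      rw [Finset.sum_add_distrib, ← Finset.mul_sum, Finset.sum_sub_distrib]
      linarith
    have h := hf.2 _ hmem
    have h3 : ∑ i, (y i - (f i + t * (u i - f i))) ^ 2 =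
        ∑ i, (y i - f i) ^ 2 - 2 * t * A + t ^ 2 * B := by
      rw [hA, hB, Finset.mul_sum, Finset.mul_sum, ← Finset.sum_sub_distrib,
        ← Finset.sum_add_distrib]
      exact Finset.sum_congr rfl fun i _ => by ring
    linarith
  by_contra hcon
  have hA0 : 0 < A := not_le.1 hcon
  -- Any `t < 2 * A / B` in `(0, 1]` contradicts `hstep` when `A > 0`.
  have h1 := hstep (A / (A + B)) (by positivity) ((div_le_one (by positivity)).2 (by linarith))
  have hAB : 0 < A + B := by positivity
  have h2 : 2 * (A / (A + B)) * A - (A / (A + B)) ^ 2 * B =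
      A ^ 2 * (2 * A + B) / (A + B) ^ 2 := by
    field_simp
    ring
  have h3 : 0 < A ^ 2 * (2 * A + B) / (A + B) ^ 2 := by positivity
  linarith

theorem RootedTree.IsLeastSquares.sum_sq_sub_le {T : RootedTree N} {y f u : N → ℝ}
    (hf : T.IsLeastSquares y f) (hu : u ∈ T.flows) (μ : N → ℝ) :
    ∑ i, (f i - μ i) ^ 2 ≤ ∑ i, (u i - μ i) ^ 2 +
      ∑ i, (2 * (y i - μ i) * (f i - u i) - (f i - u i) ^ 2) := by
  have h := hf.inner_le_zero hu
  have h1 : ∑ i, (f i - μ i) ^ 2 = ∑ i, (u i - μ i) ^ 2 +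
      ∑ i, (2 * (y i - μ i) * (f i - u i) - (f i - u i) ^ 2) +
      2 * ∑ i, (y i - f i) * (u i - f i) := by
    rw [Finset.mul_sum, ← Finset.sum_add_distrib, ← Finset.sum_add_distrib]
    exact Finset.sum_congr rfl fun i _ => by ring
  linarith

/-- If the nodes split into a distinguished block and a family of blocks, the risk of the least
squares estimator is at most the approximation error of any flow `u` plus the sum of the noise
costs of the blocks against the deviations of flows from `u`. -/
theorem lintegral_lse_le (T : RootedTree N) {μ u : N → ℝ} (hu : u ∈ T.flows) {σ c : ℝ}
    (hc : 0 ≤ c) {ι : Type*} {s : Finset ι} {e₀ : ℕ → N} {e : ι → ℕ → N} {d₀ d : ℕ}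
    {W₀ : Set (ℕ → ℝ)} {W : ι → Set (ℕ → ℝ)} {h₀ : ℝ} {h : ι → ℝ}
    (hsum : ∀ F : N → ℝ, ∑ i, F i =
      ∑ i ∈ Finset.range d₀, F (e₀ i) + ∑ j ∈ s, ∑ i ∈ Finset.range d, F (e j i))
    (H₀ : HasNoiseBound (Real.toNNReal (σ ^ 2)) e₀ d₀ W₀ h₀)
    (H : ∀ j, HasNoiseBound (Real.toNNReal (σ ^ 2)) (e j) d (W j) (h j))
    (hh₀ : 0 ≤ h₀) (hh : ∀ j, 0 ≤ h j)
    (hW₀ : ∀ f ∈ T.flows, (fun i => f (e₀ i) - u (e₀ i)) ∈ W₀)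
    (hW : ∀ f ∈ T.flows, ∀ j, (fun i => f (e j i) - u (e j i)) ∈ W j) :
    ∫⁻ y, ENNReal.ofReal (c * ∑ i, (T.lse y i - μ i) ^ 2) ∂(obsLaw σ μ) ≤
      ENNReal.ofReal (c * (∑ i, (u i - μ i) ^ 2 + σ ^ 2 * (h₀ + ∑ j ∈ s, h j))) := by
  obtain ⟨Φ₀, hm₀, hi₀, hb₀⟩ := H₀
  choose Φ hm hi hb using H
  set Ψ : (N → ℝ) → ℝ≥0∞ := fun ε => Φ₀ ε + ∑ j ∈ s, Φ j ε with hΨ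
  have hΨm : Measurable Ψ := hm₀.add (Finset.measurable_sum s fun j _ => hm j)
  have hΨi : ∫⁻ ε, Ψ ε ∂(noiseLaw N (Real.toNNReal (σ ^ 2))) ≤
      ENNReal.ofReal (σ ^ 2 * (h₀ + ∑ j ∈ s, h j)) := by
    rw [lintegral_add_left hm₀, lintegral_finsetSum _ fun j _ => hm j,
      ENNReal.ofReal_mul (sq_nonneg σ), ENNReal.ofReal_add hh₀ (Finset.sum_nonneg fun j _ => hh j),
      ENNReal.ofReal_sum_of_nonneg fun j _ => hh j, mul_add, Finset.mul_sum]
    exact add_le_add hi₀ (Finset.sum_le_sum fun j _ => hi j)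
  have hpt : ∀ y : N → ℝ, ENNReal.ofReal (c * ∑ i, (T.lse y i - μ i) ^ 2) ≤
      ENNReal.ofReal c * (ENNReal.ofReal (∑ i, (u i - μ i) ^ 2) + Ψ fun i => y i - μ i) := by
    intro y
    have hf := T.lse_isLeastSquares y
    rw [ENNReal.ofReal_mul hc]
    refine mul_le_mul_right ((ENNReal.ofReal_le_ofReal (hf.sum_sq_sub_le hu μ)).trans ?_) _
    refine ENNReal.ofReal_add_le.trans (add_le_add le_rfl ?_)
    rw [hsum]
    refine ENNReal.ofReal_add_le.trans (add_le_add (hb₀ _ _ (hW₀ _ hf.1)) ?_)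
    refine (Finset.le_sum_of_subadditive ENNReal.ofReal ENNReal.ofReal_zero.le
      (fun _ _ => ENNReal.ofReal_add_le) _ _).trans ?_
    exact Finset.sum_le_sum fun j _ => hb j (fun i => y i - μ i) _ (hW _ hf.1 j)
  have hmp := measurePreserving_sub_obsLaw σ μ
  have herr : 0 ≤ ∑ i, (u i - μ i) ^ 2 := Finset.sum_nonneg fun i _ => sq_nonneg _
  have hnoise : 0 ≤ σ ^ 2 * (h₀ + ∑ j ∈ s, h j) :=
    mul_nonneg (sq_nonneg σ) (add_nonneg hh₀ (Finset.sum_nonneg fun j _ => hh j))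
  have : IsProbabilityMeasure (obsLaw σ μ) := by unfold obsLaw; infer_instance
  have hcomp := hmp.lintegral_comp hΨm
  have hΨc : Measurable fun y : N → ℝ => Ψ fun i => y i - μ i := hΨm.comp hmp.measurable
  refine (lintegral_mono hpt).trans ?_
  rw [lintegral_const_mul _ (hΨc.const_add _),
    lintegral_add_left measurable_const, lintegral_const, measure_univ, mul_one, hcomp,
    ENNReal.ofReal_mul hc, ENNReal.ofReal_add herr hnoise]
  exact mul_le_mul_right (add_le_add le_rfl hΨi) _

end Oracle

/-! ### Flows on the spider -/

section Spider

variable {m l : ℕ}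

/-- The `i`-th node of the `j`-th path, with the root as a junk value for `l ≤ i`. -/
def pathNode (j : Fin m) (i : ℕ) : Option (Fin m × Fin l) :=
  if h : i < l then some (j, ⟨i, h⟩) else none

theorem pathNode_of_lt (j : Fin m) {i : ℕ} (h : i < l) :
    pathNode j i = some (j, (⟨i, h⟩ : Fin l)) := dif_pos h

theorem injOn_pathNode (j : Fin m) :
    Set.InjOn (pathNode j : ℕ → Option (Fin m × Fin l)) (Set.Iio l) := by
  intro i hi i' hi' h
  rw [pathNode_of_lt j hi, pathNode_of_lt j hi'] at h
  exact congrArg Fin.val (Prod.ext_iff.1 (Option.some_inj.1 h)).2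

theorem sum_spider (F : Option (Fin m × Fin l) → ℝ) :
    ∑ i, F i = F none + ∑ j, ∑ i ∈ Finset.range l, F (pathNode j i) := by
  rw [Fintype.sum_option, Fintype.sum_prod_type]
  congr 1
  refine Finset.sum_congr rfl fun j _ => ?_
  rw [← Fin.sum_univ_eq_sum_range (fun i => F (pathNode j i))]
  exact Finset.sum_congr rfl fun i _ => by rw [pathNode_of_lt j i.2]

theorem some_mem_children_root {j : Fin m} {k : Fin l} :
    some (j, k) ∈ (spider m l).children none ↔ k.val = 0 := by
  by_cases hk : k.val = 0 <;> simp [RootedTree.children, spider, hk]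

theorem some_mem_children_some {j j' : Fin m} {k k' : Fin l} :
    some (j', k') ∈ (spider m l).children (some (j, k)) ↔ j' = j ∧ k'.val = k.val + 1 := by
  by_cases hk : k'.val = 0
  · simp [RootedTree.children, spider, hk]
  · have h : some (j', k') ∈ (spider m l).children (some (j, k)) ↔
        (spider m l).parent (some (j', k')) = some (some (j, k)) := by
      simp [RootedTree.children]
    rw [h]
    simp only [spider, Option.map_some, if_neg hk, Option.some_inj, Prod.mk.injEq, Fin.ext_iff]
    omega

theorem none_notMem_children {v : Option (Fin m × Fin l)} :
    none ∉ (spider m l).children v := by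
  simp [RootedTree.children, spider]

theorem sum_children_root (hl : 0 < l) (f : Option (Fin m × Fin l) → ℝ) :
    ∑ i ∈ (spider m l).children none, f i = ∑ j, f (pathNode j 0) := by
  refine (Finset.sum_bij (fun j _ => pathNode j 0) (fun j _ => ?_) (fun j _ j' _ h => ?_)
    (fun v hv => ?_) fun _ _ => rfl).symm
  · rw [pathNode_of_lt j hl, some_mem_children_root]
  · rw [pathNode_of_lt j hl, pathNode_of_lt j' hl] at h
    exact (Prod.ext_iff.1 (Option.some_inj.1 h)).1
  · rcases v with _ | ⟨j, k⟩
    · exact absurd hv none_notMem_children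
    · have hk := some_mem_children_root.1 hv
      exact ⟨j, Finset.mem_univ j, by
        rw [pathNode_of_lt j hl]
        exact congrArg (fun k => some (j, k)) (Fin.ext hk.symm)⟩

theorem sum_children_pathNode (f : Option (Fin m × Fin l) → ℝ) (j : Fin m) {i : ℕ}
    (hi : i < l) : ∑ c ∈ (spider m l).children (pathNode j i), f c =
      if i + 1 < l then f (pathNode j (i + 1)) else 0 := by
  split_ifs with h
  · have : (spider m l).children (pathNode j i) = {pathNode j (i + 1)} := by
      ext v
      rw [Finset.mem_singleton, pathNode_of_lt j hi, pathNode_of_lt j h]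
      rcases v with _ | ⟨j', k⟩
      · simp [none_notMem_children]
      · rw [some_mem_children_some, Option.some_inj, Prod.mk.injEq, Fin.ext_iff (a := k)]
    rw [this, Finset.sum_singleton]
  · have : (spider m l).children (pathNode j i) = ∅ := by
      refine Finset.eq_empty_of_forall_notMem fun v hv => ?_
      rw [pathNode_of_lt j hi] at hv
      rcases v with _ | ⟨j', k⟩
      · exact none_notMem_children hv
      · have h1 := (some_mem_children_some.1 hv).2
        have h2 := k.2
        simp only at h1
        omega
    rw [this, Finset.sum_empty]

theorem mem_flows_spider (hl : 0 < l) {f : Option (Fin m × Fin l) → ℝ} :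
    f ∈ (spider m l).flows ↔ ∑ j, f (pathNode j 0) ≤ f none ∧
      ∀ j, AntitoneOn (fun i => f (pathNode j i)) (Set.Iio l) ∧ ∀ i < l, 0 ≤ f (pathNode j i) := by
  constructor
  · intro hf
    have hstep : ∀ j i, i < l →
        (if i + 1 < l then f (pathNode j (i + 1)) else 0) ≤ f (pathNode j i) := fun j i hi => by
      rw [← sum_children_pathNode f j hi]
      exact hf _
    refine ⟨by rw [← sum_children_root hl]; exact hf none, fun j => ⟨?_, ?_⟩⟩
    · have key : ∀ i k, i + k < l → f (pathNode j (i + k)) ≤ f (pathNode j i) := by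
        intro i k
        induction k with
        | zero => intro _; exact le_rfl
        | succ k ih =>
          intro hk
          have h1 := hstep j (i + k) (by omega)
          rw [if_pos (by omega)] at h1
          exact h1.trans (ih (by omega))
      intro i hi i' hi' hii
      obtain ⟨k, rfl⟩ := Nat.exists_eq_add_of_le hii
      exact key i k hi'
    · have key : ∀ k i, i + k + 1 = l → 0 ≤ f (pathNode j i) := by
        intro k
        induction k with
        | zero =>
          intro i hi
          have h1 := hstep j i (by omega)
          rwa [if_neg (by omega)] at h1
        | succ k ih =>
          intro i hi
          have h1 := hstep j i (by omega)
          rw [if_pos (by omega)] at h1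
          exact (ih (i + 1) (by omega)).trans h1
      exact fun i hi => key (l - 1 - i) i (by omega)
  · rintro ⟨h0, h⟩ (_ | ⟨j, k⟩)
    · rw [sum_children_root hl]
      exact h0
    · have hk : (some (j, k) : Option (Fin m × Fin l)) = pathNode j k := (pathNode_of_lt j k.2).symm
      rw [hk, sum_children_pathNode f j k.2]
      split_ifs with h1
      · exact (h j).1 k.2 h1 (Nat.le_succ _)
      · exact (h j).2 k k.2

/-- The path which consists of the root and the `j`-th path of the spider. -/
def rootedPath (j : Fin m) (i : ℕ) : Option (Fin m × Fin l) :=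
  if i = 0 then none else pathNode j (i - 1)

theorem injOn_rootedPath (j : Fin m) :
    Set.InjOn (rootedPath j : ℕ → Option (Fin m × Fin l)) (Set.Iio (l + 1)) := by
  intro i hi i' hi' h
  have hi1 : i < l + 1 := hi
  have hi1' : i' < l + 1 := hi'
  rcases i with _ | i <;> rcases i' with _ | i'
  · rfl
  · simp [rootedPath, pathNode_of_lt j (show i' < l by omega)] at h
  · simp [rootedPath, pathNode_of_lt j (show i < l by omega)] at h
  · simpa [rootedPath, pathNode_of_lt j (show i < l by omega),
      pathNode_of_lt j (show i' < l by omega)] using h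

/-- Fit by the zero flow, with the root attached to one of the paths. -/
theorem risk_zero_le {σ c : ℝ} (hc : 0 ≤ c) (hl : 0 < l) (hm : 0 < m)
    (μ : Option (Fin m × Fin l) → ℝ) :
    ∫⁻ y, ENNReal.ofReal (c * ∑ i, ((spider m l).lse y i - μ i) ^ 2) ∂(obsLaw σ μ) ≤
      ENNReal.ofReal (c * (∑ i, μ i ^ 2 + σ ^ 2 *
        (harmonic (l + 1) / 2 + (m - 1) * (harmonic l / 2)))) := by
  set j₀ : Fin m := ⟨0, hm⟩
  have h := lintegral_lse_le (spider m l) (μ := μ) (spider m l).zero_mem_flows (σ := σ) hc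
    (s := Finset.univ.erase j₀) (e₀ := rootedPath j₀) (e := pathNode) (d₀ := l + 1) (d := l)
    (fun F => ?_) (hasNoiseBound_antitone_nonneg (injOn_rootedPath j₀))
    (fun j => hasNoiseBound_antitone_nonneg (injOn_pathNode j))
    (div_nonneg (harmonic_nonneg_real _) zero_le_two)
    (fun j => div_nonneg (harmonic_nonneg_real _) zero_le_two) (fun f hf => ?_)
    (fun f hf j => ?_)
  · simpa [Nat.cast_pred hm] using h
  · rw [sum_spider, ← Finset.add_sum_erase _ _ (Finset.mem_univ j₀), Finset.sum_range_succ']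
    simp only [rootedPath]
    simp
    ring
  · obtain ⟨h0, hj⟩ := (mem_flows_spider hl).1 hf
    have hroot : f (pathNode j₀ 0) ≤ f none := le_trans
      (Finset.single_le_sum (f := fun j => f (pathNode j 0)) (fun j _ => (hj j).2 0 hl)
        (Finset.mem_univ j₀)) h0
    have h00 := (hj j₀).2 0 hl
    have hpath : ∀ i < l, f (pathNode j₀ i) ≤ f (pathNode j₀ 0) := fun i hi =>
      (hj j₀).1 hl hi (Nat.zero_le i)
    simp only [Pi.zero_apply, sub_zero]
    refine ⟨fun i hi i' hi' hii => ?_, fun i hi => ?_⟩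
    · have hi1 : i < l + 1 := hi
      have hi1' : i' < l + 1 := hi'
      rcases i with _ | i <;> rcases i' with _ | i'
      · exact le_rfl
      · simpa [rootedPath] using (hpath i' (by omega)).trans hroot
      · omega
      · simpa [rootedPath] using (hj j₀).1 (show i < l by omega) (show i' < l by omega)
          (by omega)
    · rcases i with _ | i
      · simpa [rootedPath] using h00.trans hroot
      · simpa [rootedPath] using (hj j₀).2 i (by omega)
  · simpa using ((mem_flows_spider hl).1 hf).2 j

/-- Fit by a step function of resolution `Δ` on every path, with the exact value at the root. -/
theorem risk_step_le {σ c Δ : ℝ} (hc : 0 ≤ c) (hl : 0 < l) (hΔ : 0 < Δ)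
    {μ : Option (Fin m × Fin l) → ℝ} (hμ : μ ∈ (spider m l).flows) :
    ∫⁻ y, ENNReal.ofReal (c * ∑ i, ((spider m l).lse y i - μ i) ^ 2) ∂(obsLaw σ μ) ≤
      ENNReal.ofReal (c * (m * l * Δ ^ 2 + σ ^ 2 *
        (1 + (μ none / Δ + m) * (harmonic l / 2)))) := by
  obtain ⟨h0, hj⟩ := (mem_flows_spider hl).1 hμ
  have hq : ∀ j : Fin m, ∀ i < l,
      μ (pathNode j i) ≤ ((⌊μ (pathNode j 0) / Δ⌋₊ + 1 : ℕ) : ℝ) * Δ := fun j i hi => by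
    refine ((hj j).1 hl hi (Nat.zero_le i)).trans ?_
    rw [← div_le_iff₀ hΔ]
    push_cast
    exact (Nat.lt_floor_add_one _).le
  choose u hu hu0 hua hue hun using fun j => exists_path_approx (v := Real.toNNReal (σ ^ 2)) hΔ.le
    ⌊μ (pathNode j 0) / Δ⌋₊ (injOn_pathNode j) (hj j).1 (hj j).2 (hq j)
  set U : Option (Fin m × Fin l) → ℝ := fun v => v.elim (μ none) fun p => u p.1 p.2 with hU
  have hU1 : ∀ j, ∀ i < l, U (pathNode j i) = u j i := fun j i hi => by
    rw [pathNode_of_lt j hi]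
    rfl
  have hUflow : U ∈ (spider m l).flows := by
    refine (mem_flows_spider hl).2 ⟨?_, fun j => ⟨fun i hi i' hi' hii => ?_, fun i hi => ?_⟩⟩
    · refine (Finset.sum_le_sum fun j _ => ?_).trans h0
      rw [hU1 j 0 hl]
      exact hua j 0 hl
    · simp only
      rw [hU1 j i hi, hU1 j i' hi']
      exact hu j hi hi' hii
    · rw [hU1 j i hi]
      exact hu0 j i hi
  have hH := harmonic_nonneg_real l
  have herr : ∑ i, (U i - μ i) ^ 2 ≤ m * l * Δ ^ 2 := by
    rw [sum_spider]
    have h1 : ∀ j : Fin m, ∑ i ∈ Finset.range l, (U (pathNode j i) - μ (pathNode j i)) ^ 2 ≤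
        l * Δ ^ 2 := fun j => by
      rw [Finset.sum_congr rfl fun i hi => by rw [hU1 j i (Finset.mem_range.1 hi)]]
      exact hue j
    have h2 := Finset.sum_le_sum fun j (_ : j ∈ Finset.univ) => h1 j
    have h3 : U none - μ none = 0 := sub_self _
    rw [h3]
    simp only [Finset.sum_const, Finset.card_univ, Fintype.card_fin, nsmul_eq_mul] at h2
    linarith
  have hcost : ∑ j : Fin m, ((⌊μ (pathNode j 0) / Δ⌋₊ + 1 : ℕ) : ℝ) * harmonic l / 2 ≤
      (μ none / Δ + m) * (harmonic l / 2) := by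
    simp only [mul_div_assoc]
    rw [← Finset.sum_mul]
    refine mul_le_mul_of_nonneg_right ?_ (by positivity)
    push_cast
    rw [Finset.sum_add_distrib]
    have h1 : ∑ j : Fin m, ((⌊μ (pathNode j 0) / Δ⌋₊ : ℕ) : ℝ) ≤ μ none / Δ := by
      refine (Finset.sum_le_sum fun j _ =>
        Nat.floor_le (div_nonneg ((hj j).2 0 hl) hΔ.le)).trans ?_
      rw [← Finset.sum_div]
      exact div_le_div_of_nonneg_right h0 hΔ.le
    simpa using h1
  -- `pathNode` has a junk value beyond `l`, so deviations are compared on `i < l` only.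
  have h := lintegral_lse_le (spider m l) (μ := μ) hUflow (σ := σ) hc
    (s := Finset.univ) (e₀ := fun _ => none) (e := pathNode) (d₀ := 1) (d := l)
    (h := fun j => ((⌊μ (pathNode j 0) / Δ⌋₊ + 1 : ℕ) : ℝ) * harmonic l / 2)
    (W := fun j => {w | ∃ w' ∈ pathDeviations l (u j), ∀ i < l, w i = w' i})
    (fun F => by rw [sum_spider]; simp)
    (hasNoiseBound_antitone (d := 1) (fun i hi i' hi' _ => by
      have : i < 1 := hi
      have : i' < 1 := hi'
      omega))
    (fun j => ?_) (harmonic_nonneg_real 1) (fun j => by positivity) (fun f hf => ?_)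
    (fun f hf j => ?_)
  · refine h.trans (ENNReal.ofReal_le_ofReal (mul_le_mul_of_nonneg_left ?_ hc))
    refine add_le_add herr (mul_le_mul_of_nonneg_left (add_le_add ?_ hcost) (sq_nonneg σ))
    simp [harmonic]
  · obtain ⟨Φ, h1, h2, h3⟩ := hun j
    refine ⟨Φ, h1, h2, ?_⟩
    rintro ε w ⟨w', hw', hww⟩
    rw [Finset.sum_congr rfl fun i hi => by rw [hww i (Finset.mem_range.1 hi)]]
    exact h3 ε w' hw'
  · exact fun i _ i' _ _ => le_rfl
  · obtain ⟨-, hfj⟩ := (mem_flows_spider hl).1 hf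
    exact ⟨_, ⟨_, (hfj j).1, (hfj j).2, rfl⟩, fun i hi => by simp only [hU1 j i hi]⟩

/-- On each level of the spider a flow carries at most its value at the root. -/
theorem sum_sq_flow_le (hl : 0 < l) {μ : Option (Fin m × Fin l) → ℝ}
    (hμ : μ ∈ (spider m l).flows) : ∑ i, μ i ^ 2 ≤ (l + 1) * μ none ^ 2 := by
  obtain ⟨h0, hj⟩ := (mem_flows_spider hl).1 hμ
  rw [sum_spider, Finset.sum_comm]
  have hlevel : ∀ i ∈ Finset.range l, ∑ j : Fin m, μ (pathNode j i) ^ 2 ≤ μ none ^ 2 := by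
    intro i hi
    have hi' := Finset.mem_range.1 hi
    have h1 : ∑ j : Fin m, μ (pathNode j i) ≤ μ none :=
      (Finset.sum_le_sum fun j _ => (hj j).1 hl hi' (Nat.zero_le i)).trans h0
    have h2 : 0 ≤ ∑ j : Fin m, μ (pathNode j i) := Finset.sum_nonneg fun j _ => (hj j).2 i hi'
    exact (Finset.sum_sq_le_sq_sum_of_nonneg fun j _ => (hj j).2 i hi').trans
      (pow_le_pow_left₀ h2 h1 2)
  have := Finset.sum_le_card_nsmul _ _ _ hlevel
  simp only [Finset.card_range, nsmul_eq_mul] at this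
  linarith

end Spider

/-! ### Balancing approximation error and noise cost -/

theorem risk_deepTree_le {α : ℝ} (hα₀ : 0 ≤ α) (hα₁ : α ≤ 1) {n : ℕ} (hn : 1 ≤ n) {σ : ℝ}
    (hσ : 0 < σ) {V : ℝ} (hV : 0 ≤ V)
    {μ : Option (Fin ⌈(n : ℝ) ^ α⌉₊ × Fin ⌈(n : ℝ) ^ (1 - α)⌉₊) → ℝ}
    (hμ : μ ∈ (deepTree α n).flows) (hμV : μ none ≤ V) :
    ∫⁻ y, ENNReal.ofReal ((1 / (n : ℝ)) * ∑ i, ((deepTree α n).lse y i - μ i) ^ 2)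
        ∂(obsLaw σ μ) ≤
      ENNReal.ofReal
        (2 * (σ ^ 2 * V * Real.log (Real.exp 1 * n) / n) ^ ((2 : ℝ) / 3)
          + σ ^ 2 * Real.log (Real.exp 1 * n) / (n : ℝ) ^ (1 - α)) := by
  have hn1 : (1 : ℝ) ≤ n := by exact_mod_cast hn
  have hn0 : (0 : ℝ) < n := by linarith
  have hM : 1 ≤ (n : ℝ) ^ α := Real.one_le_rpow hn1 hα₀
  have hMn : (n : ℝ) ^ α ≤ n := by
    simpa using Real.rpow_le_rpow_of_exponent_le hn1 hα₁
  have hdiv : (n : ℝ) ^ (1 - α) = n / (n : ℝ) ^ α := by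
    rw [Real.rpow_sub hn0, Real.rpow_one]
  have hcost₀ := noiseCost_zero_le hn hM hMn
  have hcost₁ := noiseCost_root_free_le hn hM hMn
  have hml := ceil_mul_ceil_le hM hMn
  rw [← hdiv] at hcost₀ hcost₁ hml
  have hm0 : 0 < ⌈(n : ℝ) ^ α⌉₊ := Nat.ceil_pos.2 (by positivity)
  have hl0 : 0 < ⌈(n : ℝ) ^ (1 - α)⌉₊ := Nat.ceil_pos.2 (by positivity)
  have hln : ⌈(n : ℝ) ^ (1 - α)⌉₊ ≤ n :=
    Nat.ceil_le.2 (by rw [hdiv]; exact div_le_self hn0.le hM)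
  have hL1 : 0 ≤ Real.log n := Real.log_nonneg hn1
  have hHL : (harmonic ⌈(n : ℝ) ^ (1 - α)⌉₊ : ℝ) ≤ 1 + Real.log n :=
    (harmonic_mono_real hln).trans (harmonic_le_one_add_log n)
  rw [log_exp_one_mul hn]
  set L : ℝ := 1 + Real.log n with hL
  have hL0 : 0 < L := by linarith
  set x : ℝ := σ ^ 2 * V * L / n with hx
  have hx0 : 0 ≤ x := by positivity
  set D : ℝ := x ^ ((1 : ℝ) / 3) with hD
  have hD0 : 0 ≤ D := Real.rpow_nonneg hx0 _
  have hD3 : D ^ 3 = x := by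
    rw [hD, ← Real.rpow_natCast, ← Real.rpow_mul hx0]
    norm_num
  have hD2 : x ^ ((2 : ℝ) / 3) = D ^ 2 := by
    rw [hD, ← Real.rpow_natCast, ← Real.rpow_mul hx0]
    norm_num
  rw [hD2]
  have htarget : ∀ R : ℝ, R ≤ 2 * (n * D ^ 2) + σ ^ 2 * ((n : ℝ) ^ α * L) →
      1 / (n : ℝ) * R ≤ 2 * D ^ 2 + σ ^ 2 * L / (n : ℝ) ^ (1 - α) := by
    intro R hR
    have h1 := mul_le_mul_of_nonneg_left hR (show 0 ≤ 1 / (n : ℝ) by positivity)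
    refine h1.trans (le_of_eq ?_)
    rw [hdiv]
    field_simp
  have hxn : n * x = σ ^ 2 * V * L := by rw [hx]; field_simp
  rcases le_or_gt (n * V ^ 2) (σ ^ 2 * L) with hsmall | hlarge
  · -- The zero fit: its squared error is at most `2 * n * V ^ 2`, and `V ≤ D`.
    refine (risk_zero_le (by positivity) hl0 hm0 μ).trans
      (ENNReal.ofReal_le_ofReal (htarget _ ?_))
    have hroot : 0 ≤ μ none := by
      obtain ⟨h1, h2⟩ := (mem_flows_spider hl0).1 hμ
      exact (Finset.sum_nonneg fun j _ => (h2 j).2 0 hl0).trans h1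
    have hVD : V ≤ D := by
      refine le_of_pow_le_pow_left₀ three_ne_zero hD0 ?_
      rw [hD3, hx, le_div_iff₀ hn0]
      nlinarith [mul_le_mul_of_nonneg_left hsmall hV]
    have hsq : μ none ^ 2 ≤ D ^ 2 := pow_le_pow_left₀ hroot (hμV.trans hVD) 2
    have hl1 : ((⌈(n : ℝ) ^ (1 - α)⌉₊ : ℕ) : ℝ) + 1 ≤ 2 * n := by
      have : ((⌈(n : ℝ) ^ (1 - α)⌉₊ : ℕ) : ℝ) ≤ n := by exact_mod_cast hln
      linarith
    have herr := sum_sq_flow_le hl0 hμ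
    have h3 := mul_le_mul hl1 hsq (sq_nonneg _) (by positivity)
    have h4 := mul_le_mul_of_nonneg_left hcost₀ (sq_nonneg σ)
    linarith
  · -- Step functions of resolution `D / 2`: then `n * D ^ 2 / 2` bounds the squared error,
    -- `n * D ^ 2` the cost of the steps, and another `n * D ^ 2 / 2` the excess cost at the root.
    have hVpos : 0 < V := by
      rcases hV.eq_or_lt with rfl | h
      · have : 0 < σ ^ 2 * L := by positivity
        norm_num at hlarge
        linarith
      · exact h
    have hDpos : 0 < D := Real.rpow_pos_of_pos (by positivity) _
    refine (risk_step_le (by positivity) hl0 (half_pos hDpos) hμ).trans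
      (ENNReal.ofReal_le_ofReal (htarget _ ?_))
    have hml' : ((⌈(n : ℝ) ^ α⌉₊ : ℕ) : ℝ) * ((⌈(n : ℝ) ^ (1 - α)⌉₊ : ℕ) : ℝ) ≤ 2 * n := by
      exact_mod_cast hml
    have h1 := mul_le_mul_of_nonneg_right hml' (sq_nonneg (D / 2))
    have hstep : σ ^ 2 * (μ none / (D / 2) * (harmonic ⌈(n : ℝ) ^ (1 - α)⌉₊ / 2)) ≤ n * D ^ 2 := by
      have h2 : μ none * (harmonic ⌈(n : ℝ) ^ (1 - α)⌉₊ : ℝ) ≤ V * L :=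
        mul_le_mul hμV hHL (harmonic_nonneg_real _) hV
      have h3 : σ ^ 2 * (μ none / (D / 2) * (harmonic ⌈(n : ℝ) ^ (1 - α)⌉₊ / 2)) =
          σ ^ 2 * (μ none * (harmonic ⌈(n : ℝ) ^ (1 - α)⌉₊ : ℝ)) / D := by
        field_simp
      rw [h3, div_le_iff₀ hDpos]
      have h4 : n * D ^ 2 * D = σ ^ 2 * (V * L) := by
        rw [← mul_assoc (σ ^ 2), ← hxn, ← hD3]
        ring
      rw [h4]
      exact mul_le_mul_of_nonneg_left h2 (sq_nonneg σ)
    have hDlarge : σ ^ 2 * L ≤ n * D ^ 2 := by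
      refine le_of_pow_le_pow_left₀ three_ne_zero (by positivity) ?_
      have h5 : (n * D ^ 2) ^ 3 = n * (n * x) ^ 2 := by
        rw [← hD3]
        ring
      rw [h5, hxn]
      have h6 := mul_le_mul_of_nonneg_left hlarge.le (show 0 ≤ (σ ^ 2 * L) ^ 2 by positivity)
      nlinarith
    have h7 := mul_le_mul_of_nonneg_left hcost₁ (sq_nonneg σ)
    nlinarith

end TreeFlow

theorem mainTheorem4 (α : ℝ) (hα₀ : 0 ≤ α) (hα₁ : α ≤ 1) (n : ℕ) (hn : 1 ≤ n)
    (σ : ℝ) (hσ : 0 < σ) (V : ℝ) (hV : 0 ≤ V) :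
    (⨆ μ ∈ {μ | μ ∈ (TreeFlow.deepTree α n).flows ∧ μ (TreeFlow.deepTree α n).root ≤ V},
      ∫⁻ y, ENNReal.ofReal
          ((1 / (n : ℝ)) * ∑ i, ((TreeFlow.deepTree α n).lse y i - μ i) ^ 2)
        ∂(TreeFlow.obsLaw σ μ)) ≤
      ENNReal.ofReal
        (2 * (σ ^ 2 * V * Real.log (Real.exp 1 * n) / n) ^ ((2 : ℝ) / 3)
          + σ ^ 2 * Real.log (Real.exp 1 * n) / (n : ℝ) ^ (1 - α)) :=
  iSup₂_le fun _ hμ => TreeFlow.risk_deepTree_le hα₀ hα₁ hn hσ hV hμ.1 hμ.2
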